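/- Let $\mathcal O=\mathbb{Z}[\sqrt3]$, and for $x\in\mathcal O$ let $\bar x$ be its image under $\sqrt3\mapsto-\sqrt3$; $x$ is totally positive if $x>0$ and $\bar x>0$. Let $\mathrm{PGL}_2^+(\mathcal O)\subset\mathrm{PGL}_2(\mathcal O)$ be the group of classes of matrices in $\mathrm{GL}_2(\mathcal O)$ with totally positive determinant, and $\mathrm{PGL}_2^+(\mathbb{R})\subset\mathrm{PGL}_2(\mathbb{R})$ the group of classes of real matrices with positive determinant. Let $\Gamma$ be the subgroup of $\mathrm{PSL}_2(\mathbb{C})$ generated by the classes of $$U=\begin{pmatrix}\sqrt3-1&1\\-2+\sqrt3&1\end{pmatrix},\quad V=\begin{pmatrix}-1+2\sqrt3&1\\-8+3\sqrt3&-\sqrt3+1\end{pmatrix},\quad W=\begin{pmatrix}1&0\\-\sqrt3-1&1\end{pmatrix},$$ $$A=\begin{pmatrix}1&0\\-\sqrt3&1\end{pmatrix},\quad G=\begin{pmatrix}\sqrt2&\frac{\sqrt2}{2}(\sqrt3+1)\\\frac{\sqrt2}{2}(5-3\sqrt3)&\frac{\sqrt2}{2}(\sqrt3-1)\end{pmatrix}.$$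 1. The natural map $\mathrm{PSL}_2(\mathcal O)\to\mathrm{PSL}_2(\mathbb{C})$ is injective, and its image is a subgroup of $\Gamma$ of index $2$. 2. The natural map $\mathrm{PGL}_2(\mathcal O)\to\mathrm{PGL}_2(\mathbb{C})$ is injective, and under the canonical isomorphism $\mathrm{PSL}_2(\mathbb{C})\cong\mathrm{PGL}_2(\mathbb{C})$ the group $\Gamma$ is the image of the extended modular group $\mathrm{PGL}_2^+(\mathcal O)$. The usual map $\mathrm{PGL}_2^+(\mathcal O)\to\mathrm{PGL}_2^+(\mathbb{R})^2$, $[M]\mapsto([M],[\bar M])$, is injective. Its image equals the Hurwitz–Maass extension of $\mathrm{PSL}_2(\mathcal O)$, that is, the group of all pairs $([M],[\bar M])$ where $M$ is a $2\times2$ matrix with entries in $\mathcal O$ such that $\det M$ is totally positive and the ideal $(\det M)$ is the square of the ideal generated by the entries of $M$. This image is a maximal discrete subgroup of $\mathrm{PGL}_2^+(\mathbb{R})^2$: it is discrete, and no discrete subgroup of $\mathrm{PGL}_2^+(\mathbb{R})^2$ strictly contains it. -/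

import Mathlib

open scoped MatrixGroups

noncomputable section

namespace HilbertModular

/-! ### The ring `ℤ[√3]`, its real embeddings, totally positive elements -/

/-- The embedding of `ℤ[√3]` into `ℝ` given by the positive square root of `3`. -/
def embOne : ℤ√3 →+* ℝ := Zsqrtd.toReal (by norm_num)

/-- The Galois conjugate embedding, sending `√3` to `-√3`. -/
def embTwo : ℤ√3 →+* ℝ := embOne.comp (starRingEnd (ℤ√3))

/-- The inclusion of `ℤ[√3]` into `ℂ`. -/
def embC : ℤ√3 →+* ℂ := Complex.ofRealHom.comp embOne

/-- An element of `ℤ[√3]` is totally positive if both its real conjugates are positive. -/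
def TotallyPositive (x : ℤ√3) : Prop := 0 < embOne x ∧ 0 < embTwo x

theorem TotallyPositive.mul {x y : ℤ√3} (hx : TotallyPositive x) (hy : TotallyPositive y) :
    TotallyPositive (x * y) :=
  ⟨by rw [map_mul]; exact mul_pos hx.1 hy.1, by rw [map_mul]; exact mul_pos hx.2 hy.2⟩

theorem TotallyPositive.one : TotallyPositive 1 := ⟨by simp, by simp⟩

theorem TotallyPositive.of_mul {x y : ℤ√3} (hx : TotallyPositive x)
    (hxy : TotallyPositive (x * y)) : TotallyPositive y := by
  obtain ⟨h1, h2⟩ := hxy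
  rw [map_mul] at h1 h2
  exact ⟨(mul_pos_iff_of_pos_left hx.1).1 h1, (mul_pos_iff_of_pos_left hx.2).1 h2⟩

/-! ### The monodromy matrices and the group they generate -/

/-- `√2` as a complex number. -/
def sqrtTwo : ℂ := ((√2 : ℝ) : ℂ)

/-- `√3` as a complex number. -/
def sqrtThree : ℂ := ((√3 : ℝ) : ℂ)

theorem sqrtTwo_sq : sqrtTwo ^ 2 = 2 := by
  rw [sqrtTwo, ← Complex.ofReal_pow, Real.sq_sqrt (by norm_num)]; norm_num

theorem sqrtThree_sq : sqrtThree ^ 2 = 3 := by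
  rw [sqrtThree, ← Complex.ofReal_pow, Real.sq_sqrt (by norm_num)]; norm_num

def matU : SL(2, ℂ) :=
  ⟨!![sqrtThree - 1, 1; -2 + sqrtThree, 1], by rw [Matrix.det_fin_two_of]; ring⟩

def matV : SL(2, ℂ) :=
  ⟨!![-1 + 2 * sqrtThree, 1; -8 + 3 * sqrtThree, -sqrtThree + 1], by
    rw [Matrix.det_fin_two_of]; linear_combination (-2 : ℂ) * sqrtThree_sq⟩

def matW : SL(2, ℂ) :=
  ⟨!![1, 0; -sqrtThree - 1, 1], by rw [Matrix.det_fin_two_of]; ring⟩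

def matA : SL(2, ℂ) :=
  ⟨!![1, 0; -sqrtThree, 1], by rw [Matrix.det_fin_two_of]; ring⟩

def matG : SL(2, ℂ) :=
  ⟨!![sqrtTwo, sqrtTwo / 2 * (sqrtThree + 1);
      sqrtTwo / 2 * (5 - 3 * sqrtThree), sqrtTwo / 2 * (sqrtThree - 1)], by
    rw [Matrix.det_fin_two_of]
    linear_combination
      (1 / 2 * (sqrtThree - 1) - 1 / 4 * (sqrtThree + 1) * (5 - 3 * sqrtThree)) * sqrtTwo_sq +
      (3 / 2 : ℂ) * sqrtThree_sq⟩

/-- The class in `PSL₂(ℂ)` of a matrix of `SL₂(ℂ)`. -/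
def toPSL : SL(2, ℂ) →* PSL(2, ℂ) := QuotientGroup.mk' _

/-- The subgroup of `PSL₂(ℂ)` generated by the five monodromy matrices. -/
def monodromyGroup : Subgroup PSL(2, ℂ) :=
  Subgroup.closure {toPSL matU, toPSL matV, toPSL matW, toPSL matA, toPSL matG}

/-! ### `PSL₂(ℤ[√3])` in `PSL₂(ℂ)` -/

theorem SL_map_center_le {R S : Type*} [CommRing R] [CommRing S] (f : R →+* S) :
    Subgroup.center SL(2, R) ≤
      (Subgroup.center SL(2, S)).comap (Matrix.SpecialLinearGroup.map f) := by
  intro A hA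
  rw [Matrix.SpecialLinearGroup.mem_center_iff] at hA
  obtain ⟨r, hr, hA⟩ := hA
  rw [Subgroup.mem_comap, Matrix.SpecialLinearGroup.mem_center_iff]
  refine ⟨f r, by rw [← map_pow, hr, map_one], ?_⟩
  rw [Matrix.SpecialLinearGroup.map_apply_coe, ← hA]
  ext i j
  fin_cases i <;> fin_cases j <;> simp

/-- The homomorphism `PSL₂(ℤ[√3]) → PSL₂(ℂ)` induced by the inclusion `ℤ[√3] ⊆ ℂ`. -/
def pslMap : PSL(2, ℤ√3) →* PSL(2, ℂ) :=
  QuotientGroup.map _ _ (Matrix.SpecialLinearGroup.map embC) (SL_map_center_le embC)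

/-! ### The extended modular group `PGL₂⁺(ℤ[√3])` and the group `PGL₂⁺(ℝ)` -/

/-- The group `GL₂⁺(ℤ[√3])` of invertible matrices over `ℤ[√3]` with totally positive
determinant. -/
def GLTotPos : Subgroup (GL (Fin 2) (ℤ√3)) where
  carrier := {g | TotallyPositive g.val.det}
  one_mem' := by
    change TotallyPositive (Matrix.det 1)
    rw [Matrix.det_one]; exact TotallyPositive.one
  mul_mem' {a b} ha hb := by
    change TotallyPositive (a.val * b.val).det
    rw [Matrix.det_mul]; exact TotallyPositive.mul ha hb
  inv_mem' {a} ha := by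
    refine TotallyPositive.of_mul (x := a.val.det) ha ?_
    rw [← Matrix.det_mul, Units.mul_inv, Matrix.det_one]
    exact TotallyPositive.one

/-- The extended modular group `PGL₂⁺(ℤ[√3])`, a subgroup of `PGL₂(ℤ[√3])`. -/
def PGLTotPos : Subgroup PGL(2, ℤ√3) := GLTotPos.map Matrix.ProjGenLinGroup.mk

/-- `PGL₂⁺(ℝ)`: the classes in `PGL₂(ℝ)` of the real matrices with positive determinant. -/
def PGLPosReal : Subgroup PGL(2, ℝ) := (Matrix.GLPos (Fin 2) ℝ).map Matrix.ProjGenLinGroup.mk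

/-- `PGL₂(ℝ)` carries the quotient topology from `GL₂(ℝ)`. -/
instance topologicalSpacePGL : TopologicalSpace PGL(2, ℝ) :=
  TopologicalSpace.coinduced (Matrix.ProjGenLinGroup.mk : GL (Fin 2) ℝ → PGL(2, ℝ)) inferInstance

theorem map_embOne_mem (g : PGL(2, ℤ√3)) (hg : g ∈ PGLTotPos) :
    Matrix.ProjGenLinGroup.map embOne g ∈ PGLPosReal := by
  obtain ⟨a, ha, rfl⟩ := hg
  refine ⟨Matrix.GeneralLinearGroup.map embOne a, ?_, rfl⟩
  rw [SetLike.mem_coe, Matrix.mem_glpos, Matrix.GeneralLinearGroup.map_det]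
  exact ha.1

theorem map_embTwo_mem (g : PGL(2, ℤ√3)) (hg : g ∈ PGLTotPos) :
    Matrix.ProjGenLinGroup.map embTwo g ∈ PGLPosReal := by
  obtain ⟨a, ha, rfl⟩ := hg
  refine ⟨Matrix.GeneralLinearGroup.map embTwo a, ?_, rfl⟩
  rw [SetLike.mem_coe, Matrix.mem_glpos, Matrix.GeneralLinearGroup.map_det]
  exact ha.2

/-- The usual embedding `PGL₂⁺(ℤ[√3]) → PGL₂⁺(ℝ)²`, sending the class of `M` to the pair of
classes of `M` and of its Galois conjugate. -/
def usualEmbedding : PGLTotPos →* PGLPosReal × PGLPosReal :=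
  MonoidHom.prod
    (((Matrix.ProjGenLinGroup.map embOne).comp PGLTotPos.subtype).codRestrict PGLPosReal
      fun g => map_embOne_mem g.1 g.2)
    (((Matrix.ProjGenLinGroup.map embTwo).comp PGLTotPos.subtype).codRestrict PGLPosReal
      fun g => map_embTwo_mem g.1 g.2)

/-! ### The Hurwitz–Maass extension -/

/-- The ideal of `ℤ[√3]` generated by the entries of a matrix. -/
def contentIdeal (M : Matrix (Fin 2) (Fin 2) (ℤ√3)) : Ideal (ℤ√3) :=
  Ideal.span {M 0 0, M 0 1, M 1 0, M 1 1}

theorem entry_mem_contentIdeal (M : Matrix (Fin 2) (Fin 2) (ℤ√3)) (i j : Fin 2) :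
    M i j ∈ contentIdeal M := by
  apply Ideal.subset_span
  fin_cases i <;> fin_cases j <;> simp

theorem contentIdeal_le {M : Matrix (Fin 2) (Fin 2) (ℤ√3)} {I : Ideal (ℤ√3)}
    (h : ∀ i j, M i j ∈ I) : contentIdeal M ≤ I := by
  refine Ideal.span_le.2 ?_
  rintro x (rfl | rfl | rfl | rfl) <;> exact h _ _

theorem det_mem_contentIdeal_sq (M : Matrix (Fin 2) (Fin 2) (ℤ√3)) :
    M.det ∈ contentIdeal M ^ 2 := by
  rw [Matrix.det_fin_two, pow_two]
  exact sub_mem (Ideal.mul_mem_mul (entry_mem_contentIdeal _ _ _) (entry_mem_contentIdeal _ _ _))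
    (Ideal.mul_mem_mul (entry_mem_contentIdeal _ _ _) (entry_mem_contentIdeal _ _ _))

theorem contentIdeal_mul_le (M N : Matrix (Fin 2) (Fin 2) (ℤ√3)) :
    contentIdeal (M * N) ≤ contentIdeal M * contentIdeal N := by
  refine contentIdeal_le fun i j => ?_
  rw [Matrix.mul_apply]
  exact sum_mem fun k _ =>
    Ideal.mul_mem_mul (entry_mem_contentIdeal _ _ _) (entry_mem_contentIdeal _ _ _)

theorem contentIdeal_adjugate_le (M : Matrix (Fin 2) (Fin 2) (ℤ√3)) :
    contentIdeal M.adjugate ≤ contentIdeal M := by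
  refine contentIdeal_le fun i j => ?_
  rw [Matrix.adjugate_fin_two]
  fin_cases i <;> fin_cases j <;> simp [entry_mem_contentIdeal]

/-- A matrix with entries in `ℤ[√3]` is of Hurwitz–Maass type if its determinant is totally
positive and generates the square of the ideal generated by its entries. -/
def IsHurwitzMaass (M : Matrix (Fin 2) (Fin 2) (ℤ√3)) : Prop :=
  TotallyPositive M.det ∧ contentIdeal M ^ 2 = Ideal.span {M.det}

theorem IsHurwitzMaass.one : IsHurwitzMaass 1 := by
  refine ⟨by rw [Matrix.det_one]; exact TotallyPositive.one, ?_⟩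
  have h : contentIdeal 1 = ⊤ := (Ideal.eq_top_iff_one _).2 (by
    simpa using entry_mem_contentIdeal 1 0 0)
  rw [h, Matrix.det_one, Ideal.span_singleton_one, Ideal.top_pow]

theorem IsHurwitzMaass.mul {M N : Matrix (Fin 2) (Fin 2) (ℤ√3)} (hM : IsHurwitzMaass M)
    (hN : IsHurwitzMaass N) : IsHurwitzMaass (M * N) := by
  refine ⟨by rw [Matrix.det_mul]; exact hM.1.mul hN.1, le_antisymm ?_ ?_⟩
  · calc contentIdeal (M * N) ^ 2 ≤ (contentIdeal M * contentIdeal N) ^ 2 :=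
          Ideal.pow_right_mono (contentIdeal_mul_le M N) 2
      _ = Ideal.span {(M * N).det} := by
          rw [mul_pow, hM.2, hN.2, Ideal.span_singleton_mul_span_singleton, Matrix.det_mul]
  · exact (Ideal.span_singleton_le_iff_mem _).2 (det_mem_contentIdeal_sq _)

theorem IsHurwitzMaass.adjugate {M : Matrix (Fin 2) (Fin 2) (ℤ√3)} (hM : IsHurwitzMaass M) :
    IsHurwitzMaass M.adjugate := by
  have hdet : M.adjugate.det = M.det := by simp [Matrix.det_adjugate]
  refine ⟨hdet ▸ hM.1, le_antisymm ?_ ?_⟩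
  · rw [hdet, ← hM.2]
    exact Ideal.pow_right_mono (contentIdeal_adjugate_le M) 2
  · exact (Ideal.span_singleton_le_iff_mem _).2 (det_mem_contentIdeal_sq _)

/-- The Hurwitz–Maass extension of `PSL₂(ℤ[√3])`, as a subgroup of `PGL₂⁺(ℝ)²`: the pairs of
classes of `M` and of its Galois conjugate, for `M` a matrix with entries in `ℤ[√3]` whose
determinant is totally positive and generates the square of the ideal generated by the entries. -/
def hurwitzMaass : Subgroup (PGLPosReal × PGLPosReal) where
  carrier := {x | ∃ (M : Matrix (Fin 2) (Fin 2) (ℤ√3)) (g₁ g₂ : GL (Fin 2) ℝ),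
    IsHurwitzMaass M ∧ g₁.val = M.map embOne ∧ g₂.val = M.map embTwo ∧
    x.1.val = Matrix.ProjGenLinGroup.mk g₁ ∧ x.2.val = Matrix.ProjGenLinGroup.mk g₂}
  one_mem' := ⟨1, 1, 1, IsHurwitzMaass.one, by simp, by simp, by simp, by simp⟩
  mul_mem' := by
    rintro x y ⟨M, g₁, g₂, hM, h1, h2, hx1, hx2⟩ ⟨N, k₁, k₂, hN, h3, h4, hy1, hy2⟩
    refine ⟨M * N, g₁ * k₁, g₂ * k₂, hM.mul hN, ?_, ?_, ?_, ?_⟩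
    · rw [Matrix.map_mul, Units.val_mul, h1, h3]
    · rw [Matrix.map_mul, Units.val_mul, h2, h4]
    · rw [map_mul, ← hx1, ← hy1]; rfl
    · rw [map_mul, ← hx2, ← hy2]; rfl
  inv_mem' := by
    have key : ∀ (f : ℤ√3 →+* ℝ) (M : Matrix (Fin 2) (Fin 2) (ℤ√3)) (g : GL (Fin 2) ℝ),
        g.val = M.map f → ∃ k : GL (Fin 2) ℝ, k.val = M.adjugate.map f ∧
          (Matrix.ProjGenLinGroup.mk g)⁻¹ = Matrix.ProjGenLinGroup.mk k := by
      intro f M g hg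
      refine ⟨g⁻¹ * Matrix.GeneralLinearGroup.scalar (Fin 2) (Matrix.GeneralLinearGroup.det g),
        ?_, ?_⟩
      · have h : M.adjugate.map f = g.val.adjugate := by
          rw [hg]; exact f.map_adjugate M
        rw [h, Units.val_mul, Matrix.GeneralLinearGroup.coe_scalar]
        have h2 : g.val.adjugate = (g⁻¹).val * (g.val * g.val.adjugate) := by
          rw [← Matrix.mul_assoc, Units.inv_mul, Matrix.one_mul]
        rw [h2, Matrix.mul_adjugate, Matrix.GeneralLinearGroup.val_det_apply]
        congr 1
        ext i j
        fin_cases i <;> fin_cases j <;> simp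
      · rw [map_mul, Matrix.ProjGenLinGroup.mk_scalar, mul_one, map_inv]
    rintro x ⟨M, g₁, g₂, hM, h1, h2, hx1, hx2⟩
    obtain ⟨k₁, hk1, hk1'⟩ := key embOne M g₁ h1
    obtain ⟨k₂, hk2, hk2'⟩ := key embTwo M g₂ h2
    refine ⟨M.adjugate, k₁, k₂, hM.adjugate, hk1, hk2, ?_, ?_⟩
    · rw [← hk1', ← hx1]; rfl
    · rw [← hk2', ← hx2]; rfl

end HilbertModular

end

open scoped Topology

namespace HilbertModular

/-! ### Arithmetic of `ℤ[√3]` -/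

/-! Write O for `ℤ√3` and ε for the unit 2 + √3. The arithmetic input is that O is norm-Euclidean,
hence principal, and that its totally positive units are the powers of ε, so each is a square of a
unit or ε times one.

The group Γ: by the Euclidean algorithm, lower unipotents and the rotation generate SL₂(O). The
matrices A and W give all lower unipotents, because √3 and 1 + √3 form a ℤ-basis of O, and U then
gives the rotation. Up to a scalar, G is a matrix over O of determinant ε⁻¹. Hence every class in
PGL₂⁺(O) comes from PSL₂(O), possibly after multiplication by G. The class of G does not, since 2 is
not a square in O; so the index is two.

The Hurwitz–Maass extension adds nothing: the content of a matrix is principal, and dividing it out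
leaves a unit determinant.

Discreteness: a nonzero element of O cannot have both conjugates of absolute value less than one.

Maximality: let Δ be a discrete overgroup, studied through its preimage in SL₂(ℝ × ℝ). By
compactness (`exists_proj_eq_of_bounded`), any bounded sequence in this preimage repeats up to
scalars. Suitable sequences show that the translations in Δ are integral, which determines the
stabilizer of ∞ (`proj_mem_of_lower_left_eq_zero`), and that g∞ is a cusp over ℚ(√3) for every g in
Δ (`exists_mul_emb_eq_mul_emb`). As O is principal, SL₂(O) moves such a cusp back to ∞, so g lies in
the extended modular group. -/

theorem embOne_apply (x : ℤ√3) : embOne x = x.re + x.im * √3 := by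
  simp [embOne]

theorem embTwo_apply (x : ℤ√3) : embTwo x = x.re - x.im * √3 := by
  simp [embTwo, embOne_apply, starRingEnd_apply, sub_eq_add_neg]

theorem three_ne_mul_self (n : ℤ) : (3 : ℤ) ≠ n * n := by
  intro h
  have h1 : n < 2 := by nlinarith
  have h2 : -2 < n := by nlinarith
  interval_cases n <;> omega

theorem embOne_injective : Function.Injective embOne :=
  Zsqrtd.toReal_injective _ three_ne_mul_self

theorem embTwo_injective : Function.Injective embTwo :=
  embOne_injective.comp star_injective

theorem embC_injective : Function.Injective embC :=
  Complex.ofReal_injective.comp embOne_injective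

instance : IsDomain (ℤ√3) := embOne_injective.isDomain embOne

theorem embOne_mul_embTwo (x : ℤ√3) : embOne x * embTwo x = x.norm := by
  have h3 : √(3 : ℝ) ^ 2 = 3 := Real.sq_sqrt (by norm_num)
  rw [embOne_apply, embTwo_apply, Zsqrtd.norm_def]
  push_cast
  linear_combination (-(x.im : ℝ) ^ 2) * h3

theorem norm_eq_zero_iff {x : ℤ√3} : x.norm = 0 ↔ x = 0 := by
  refine ⟨fun h => ?_, fun h => by simp [h]⟩
  have h2 := embOne_mul_embTwo x
  rw [h, Int.cast_zero, mul_eq_zero] at h2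
  exact h2.elim (fun h => (map_eq_zero_iff _ embOne_injective).1 h)
    (fun h => (map_eq_zero_iff _ embTwo_injective).1 h)

/-- The norm is an integer and the product of the two conjugates. This is the source of
discreteness. -/
theorem eq_zero_of_abs_emb_lt_one {x : ℤ√3} (h1 : |embOne x| < 1) (h2 : |embTwo x| < 1) :
    x = 0 := by
  rw [← norm_eq_zero_iff, ← Int.abs_lt_one_iff]
  have h : |(x.norm : ℝ)| < 1 := by
    rw [← embOne_mul_embTwo, abs_mul]
    exact mul_lt_one_of_nonneg_of_lt_one_left (abs_nonneg _) h1 h2.le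
  exact_mod_cast h

/-- Division with remainder in `ℤ[√3]` with respect to the absolute value of the norm. -/
theorem exists_norm_sub_mul_lt (a : ℤ√3) {b : ℤ√3} (hb : b ≠ 0) :
    ∃ q : ℤ√3, (a - b * q).norm.natAbs < b.norm.natAbs := by
  have hN : (b.norm : ℝ) ≠ 0 := by exact_mod_cast norm_eq_zero_iff.not.2 hb
  have h3 : √(3 : ℝ) ^ 2 = 3 := Real.sq_sqrt (by norm_num)
  set c : ℤ√3 := a * star b with hc
  set x : ℝ := c.re / b.norm with hx
  set y : ℝ := c.im / b.norm with hy
  refine ⟨⟨round x, round y⟩, ?_⟩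
  set q : ℤ√3 := ⟨round x, round y⟩ with hq
  have hsx := abs_le.1 (abs_sub_round x)
  have hsy := abs_le.1 (abs_sub_round y)
  have hbb : b * star b = ((b.norm : ℤ) : ℤ√3) := (Zsqrtd.norm_eq_mul_conj b).symm
  have key : (a - b * q) * star b = c - ((b.norm : ℤ) : ℤ√3) * q := by
    rw [sub_mul, mul_right_comm, hbb]
  have key2 : ((a - b * q).norm : ℝ) * b.norm
      = b.norm ^ 2 * ((x - round x) ^ 2 - 3 * (y - round y) ^ 2) := by
    have h1 := congrArg (fun z : ℤ√3 => (z.norm : ℝ)) key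
    simp only [Zsqrtd.norm_mul, Zsqrtd.norm_conj, Int.cast_mul] at h1
    rw [h1, Zsqrtd.norm_def]
    have hcx : (c.re : ℝ) = b.norm * x := by rw [hx]; field_simp
    have hcy : (c.im : ℝ) = b.norm * y := by rw [hy]; field_simp
    simp [hq, hcx, hcy]
    ring
  have hlt : |(x - round x) ^ 2 - 3 * (y - round y) ^ 2| < 1 := by
    -- Both rounding errors are at most 1/2, so the form lies between -3/4 and 1/4.
    rw [abs_lt]; constructor <;> nlinarith
  have h4 : |((a - b * q).norm : ℝ)| < |(b.norm : ℝ)| := by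
    have h5 : |((a - b * q).norm : ℝ)| * |(b.norm : ℝ)| < |(b.norm : ℝ)| * |(b.norm : ℝ)| := by
      rw [← abs_mul, key2, abs_mul, abs_pow, pow_two]
      exact mul_lt_of_lt_one_right (by positivity) hlt
    exact lt_of_mul_lt_mul_right h5 (abs_nonneg _)
  have h6 : |(a - b * q).norm| < |b.norm| := by exact_mod_cast h4
  rw [Int.abs_eq_natAbs, Int.abs_eq_natAbs] at h6
  exact_mod_cast h6

/-- An element of minimal nonzero norm generates the ideal. Class number one is used twice later: to
divide out the content of a matrix, and to move every rational cusp to infinity. -/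
instance : IsPrincipalIdealRing (ℤ√3) := by
  refine ⟨fun I => ?_⟩
  by_cases hI : I = ⊥
  · subst hI; infer_instance
  obtain ⟨x0, hx0, hx0'⟩ := Submodule.exists_mem_ne_zero_of_ne_bot hI
  have hex : ∃ n : ℕ, ∃ x ∈ I, x ≠ 0 ∧ x.norm.natAbs = n := ⟨_, x0, hx0, hx0', rfl⟩
  classical
  obtain ⟨b, hbI, hb, hbn⟩ := Nat.find_spec hex
  refine ⟨b, le_antisymm (fun a ha => ?_) ?_⟩
  · obtain ⟨q, hq⟩ := exists_norm_sub_mul_lt a hb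
    have h0 : a - b * q = 0 := by
      by_contra hne
      exact Nat.find_min hex (hbn ▸ hq)
        ⟨_, I.sub_mem ha (I.mul_mem_right q hbI), hne, rfl⟩
    rw [Submodule.mem_span_singleton]
    exact ⟨q, by rw [smul_eq_mul, mul_comm]; exact (sub_eq_zero.1 h0).symm⟩
  · exact (Submodule.span_singleton_le_iff_mem _ _).2 hbI

theorem exists_coprime_reduction {R : Type*} [CommRing R] [IsDomain R] [IsPrincipalIdealRing R]
    (a : R) {b : R} (hb : b ≠ 0) :
    ∃ m a' b' : R, m ≠ 0 ∧ a = m * a' ∧ b = m * b' ∧ IsCoprime a' b' := by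
  obtain ⟨m, hm⟩ := (IsPrincipalIdealRing.principal (Ideal.span {a, b})).principal
  rw [Ideal.submodule_span_eq] at hm
  have ha' : a ∈ Ideal.span {m} := hm ▸ Ideal.subset_span (by simp)
  have hb' : b ∈ Ideal.span {m} := hm ▸ Ideal.subset_span (by simp)
  have hm' : m ∈ Ideal.span {a, b} := hm ▸ Ideal.mem_span_singleton_self m
  obtain ⟨a', rfl⟩ := Ideal.mem_span_singleton.1 ha'
  obtain ⟨b', rfl⟩ := Ideal.mem_span_singleton.1 hb'
  obtain ⟨u, v, huv⟩ := Ideal.mem_span_pair.1 hm'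
  have hm0 : m ≠ 0 := left_ne_zero_of_mul hb
  refine ⟨m, a', b', hm0, rfl, rfl, u, v, mul_left_cancel₀ hm0 ?_⟩
  linear_combination huv

/-- The totally positive fundamental unit `2 + √3`. -/
def fundUnit : ℤ√3 := ⟨2, 1⟩

theorem norm_eq_one_of_totallyPositive {u : ℤ√3} (hu : IsUnit u) (hp : TotallyPositive u) :
    u.norm = 1 := by
  have h1 := Zsqrtd.norm_eq_one_iff.2 hu
  have h2 : (0 : ℝ) < u.norm := by rw [← embOne_mul_embTwo]; exact mul_pos hp.1 hp.2
  have h3 : 0 < u.norm := by exact_mod_cast h2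
  omega

theorem isFundamental_fundUnit :
    Pell.IsFundamental (Pell.Solution₁.mk 2 1 (by norm_num) : Pell.Solution₁ 3) := by
  refine ⟨by simp, by simp, fun {b} hb => ?_⟩
  simp only [Pell.Solution₁.x_mk]; omega

/-- A totally positive unit of `ℤ[√3]` is, up to the square of a unit, `1` or `2 + √3`. -/
theorem exists_sq_eq_of_totallyPositive {u : ℤ√3} (hu : IsUnit u) (hp : TotallyPositive u) :
    ∃ v : (ℤ√3)ˣ, u = v ^ 2 ∨ u = fundUnit * v ^ 2 := by
  have hn := norm_eq_one_of_totallyPositive hu hp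
  have hn' : u.re ^ 2 - 3 * u.im ^ 2 = 1 := by rw [Zsqrtd.norm_def] at hn; linarith
  set a : Pell.Solution₁ 3 := Pell.Solution₁.mk u.re u.im hn' with ha
  have hau : (a : ℤ√3) = u := rfl
  have hre : 0 < a.x := by
    have h1 := hp.1; have h2 := hp.2
    rw [embOne_apply] at h1; rw [embTwo_apply] at h2
    have : (0 : ℝ) < u.re := by linarith
    rw [ha, Pell.Solution₁.x_mk]; exact_mod_cast this
  obtain ⟨n, hn | hn⟩ := isFundamental_fundUnit.eq_zpow_or_neg_zpow a
  · set e : Pell.Solution₁ 3 := Pell.Solution₁.mk 2 1 (by norm_num) with he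
    have hefund : (e : ℤ√3) = fundUnit := rfl
    let f : Pell.Solution₁ 3 →* (ℤ√3)ˣ := Unitary.toUnits
    have hf : ∀ z : Pell.Solution₁ 3, ((f z : (ℤ√3)ˣ) : ℤ√3) = z := fun z => rfl
    -- The parity of the exponent of ε decides whether a factor ε is left over.
    obtain ⟨k, rfl | rfl⟩ := Int.even_or_odd' n
    · refine ⟨f (e ^ k), Or.inl ?_⟩
      rw [← hau, hn, ← hf, mul_comm, zpow_mul, map_zpow]; norm_cast
    · refine ⟨f (e ^ k), Or.inr ?_⟩
      rw [← hau, hn, ← hf, ← hefund, zpow_add_one, mul_comm, mul_comm 2, zpow_mul, ← hf e, map_mul,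
        map_zpow]
      norm_cast
  · have := isFundamental_fundUnit.x_pos
    have h2 := Pell.Solution₁.x_zpow_pos this n
    rw [hn, Pell.Solution₁.x_neg] at hre
    omega

/-! ### Elementary matrices in `SL₂` -/

section Elementary

variable {R S : Type*} [CommRing R] [CommRing S]

/-- The upper unipotent matrix with entry `x`. -/
def upper (x : R) : SL(2, R) := ⟨!![1, x; 0, 1], by simp⟩

/-- The lower unipotent matrix with entry `x`. -/
def lower (x : R) : SL(2, R) := ⟨!![1, 0; x, 1], by simp⟩

/-- The rotation of order four. -/
def rot : SL(2, R) := ⟨!![0, -1; 1, 0], by simp⟩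

/-- The diagonal matrix with entries `a` and `d`. -/
def diag (a d : R) (h : a * d = 1) : SL(2, R) := ⟨!![a, 0; 0, d], by simp [h]⟩

@[simp] theorem coe_upper (x : R) : (upper x).val = !![1, x; 0, 1] := rfl
@[simp] theorem coe_lower (x : R) : (lower x).val = !![1, 0; x, 1] := rfl
@[simp] theorem coe_rot : (rot : SL(2, R)).val = !![0, -1; 1, 0] := rfl
@[simp] theorem coe_diag (a d : R) (h : a * d = 1) : (diag a d h).val = !![a, 0; 0, d] := rfl

theorem map_upper (f : R →+* S) (x : R) :
    Matrix.SpecialLinearGroup.map f (upper x) = upper (f x) := by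
  ext i j; fin_cases i <;> fin_cases j <;> simp

theorem map_lower (f : R →+* S) (x : R) :
    Matrix.SpecialLinearGroup.map f (lower x) = lower (f x) := by
  ext i j; fin_cases i <;> fin_cases j <;> simp

theorem map_rot (f : R →+* S) : Matrix.SpecialLinearGroup.map f rot = rot := by
  ext i j; fin_cases i <;> fin_cases j <;> simp

theorem lower_add (x y : R) : lower (x + y) = lower x * lower y := by
  ext i j; fin_cases i <;> fin_cases j <;> simp [Matrix.mul_apply]

theorem lower_zero : lower (0 : R) = 1 := by
  ext i j; fin_cases i <;> fin_cases j <;> simp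

theorem lower_neg (x : R) : lower (-x) = (lower x)⁻¹ := by
  rw [eq_inv_iff_mul_eq_one, ← lower_add, neg_add_cancel, lower_zero]

theorem upper_add (x y : R) : upper (x + y) = upper x * upper y := by
  ext i j; fin_cases i <;> fin_cases j <;> simp [Matrix.mul_apply, add_comm]

theorem upper_zero : upper (0 : R) = 1 := by
  ext i j; fin_cases i <;> fin_cases j <;> simp

theorem upper_neg (x : R) : upper (-x) = (upper x)⁻¹ := by
  rw [eq_inv_iff_mul_eq_one, ← upper_add, neg_add_cancel, upper_zero]

theorem upper_eq_conj_lower (x : R) : upper x = rot * lower (-x) * rot⁻¹ := by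
  rw [eq_mul_inv_iff_mul_eq]
  ext i j; fin_cases i <;> fin_cases j <;> simp [Matrix.mul_apply]

/-- Puts a diagonal matrix in any group containing the rotation and the two unipotents. It serves
over `ℤ√3` and, with `a` a non-integral translation, over `ℝ × ℝ`. -/
theorem diag_eq_mul (a d : R) (h : a * d = 1) :
    diag a d h = upper a * lower (-d) * upper a * rot := by
  ext i j
  fin_cases i <;> fin_cases j <;> simp [Matrix.mul_apply]
  · linear_combination -a * h
  · linear_combination -h
  · linear_combination h

theorem diag_inv (a d : R) (h : a * d = 1) :
    (diag a d h)⁻¹ = diag d a (by rw [mul_comm, h]) := by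
  rw [inv_eq_iff_mul_eq_one]
  ext i j
  fin_cases i <;> fin_cases j <;> simp [Matrix.mul_apply, h, mul_comm d a]

theorem diag_conj_upper (a d : R) (h : a * d = 1) (x : R) :
    diag a d h * upper x * (diag a d h)⁻¹ = upper (a ^ 2 * x) := by
  rw [mul_inv_eq_iff_eq_mul]
  ext i j
  fin_cases i <;> fin_cases j <;> simp [Matrix.mul_apply]
  linear_combination (-x * a) * h

theorem det_entries (g : SL(2, R)) : g 0 0 * g 1 1 - g 0 1 * g 1 0 = 1 := by
  have h := g.det_coe; rwa [Matrix.det_fin_two] at h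

/-- An element of `SL₂` fixing the cusp at infinity is diagonal times upper unipotent. -/
theorem eq_diag_mul_upper (g : SL(2, R)) (hc : g 1 0 = 0) :
    ∃ h : g 0 0 * g 1 1 = 1, g = diag (g 0 0) (g 1 1) h * upper (g 1 1 * g 0 1) := by
  have h : g 0 0 * g 1 1 = 1 := by simpa [hc] using det_entries g
  refine ⟨h, ?_⟩
  ext i j
  fin_cases i <;> fin_cases j <;> simp [Matrix.mul_apply, hc]
  linear_combination (-g 0 1) * h

end Elementary

/-- `SL₂(ℤ[√3])` is generated by the lower unipotent matrices and the rotation. -/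
theorem eq_top_of_lower_mem (H : Subgroup SL(2, ℤ√3)) (hrot : rot ∈ H)
    (hlow : ∀ x, lower x ∈ H) : H = ⊤ := by
  have hup : ∀ x, upper x ∈ H := fun x => by
    rw [upper_eq_conj_lower]
    exact H.mul_mem (H.mul_mem hrot (hlow _)) (H.inv_mem hrot)
  suffices h : ∀ n : ℕ, ∀ g : SL(2, ℤ√3), (g 1 0).norm.natAbs = n → g ∈ H from
    (Subgroup.eq_top_iff' H).2 fun g => h _ g rfl
  intro n
  induction n using Nat.strong_induction_on with
  | _ n ih =>
    intro g hg
    by_cases hc : g 1 0 = 0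
    · obtain ⟨h, hgd⟩ := eq_diag_mul_upper g hc
      rw [hgd, diag_eq_mul]
      exact H.mul_mem (H.mul_mem (H.mul_mem (H.mul_mem (hup _) (hlow _)) (hup _)) hrot) (hup _)
    -- One step of the Euclidean algorithm on the first column: subtract `q` times the lower entry,
    -- then let the rotation bring the remainder to the lower left.
    · obtain ⟨q, hq⟩ := exists_norm_sub_mul_lt (g 0 0) hc
      have h1 : rot * (upper (-q) * g) ∈ H := by
        refine ih _ (hg ▸ hq) _ ?_
        have : (rot * (upper (-q) * g)).val 1 0 = g 0 0 - g 1 0 * q := by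
          rw [Matrix.SpecialLinearGroup.coe_mul, Matrix.SpecialLinearGroup.coe_mul]
          simp only [Matrix.mul_apply, Fin.sum_univ_two]
          simp
          ring
        rw [this]
      exact (Subgroup.mul_mem_cancel_left H (hup _)).1 ((Subgroup.mul_mem_cancel_left H hrot).1 h1)

/-! ### The monodromy group -/

theorem embC_apply (x : ℤ√3) : embC x = x.re + x.im * sqrtThree := by
  simp [embC, embOne_apply, sqrtThree]

theorem pslMap_toPSL (g : SL(2, ℤ√3)) :
    pslMap (QuotientGroup.mk g) = toPSL (Matrix.SpecialLinearGroup.map embC g) := rfl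

theorem toPGL_pslMap (x : PSL(2, ℤ√3)) : Matrix.ProjectiveSpecialLinearGroup.toPGL (pslMap x) =
    Matrix.ProjGenLinGroup.map embC (Matrix.ProjectiveSpecialLinearGroup.toPGL x) := by
  induction x using QuotientGroup.induction_on with
  | H g =>
    rw [pslMap_toPSL, toPSL, QuotientGroup.mk'_apply, Matrix.ProjectiveSpecialLinearGroup.toPGL_mk,
      Matrix.ProjectiveSpecialLinearGroup.toPGL_mk, Matrix.ProjGenLinGroup.map_mk]
    congr 1
    ext i j
    simp

theorem projGenLinGroup_map_injective {n : Type*} [Fintype n] [DecidableEq n]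
    {R S : Type*} [CommRing R] [CommRing S] {f : R →+* S} (hf : Function.Injective f) :
    Function.Injective (Matrix.ProjGenLinGroup.map (n := n) f) := by
  have hinj : Function.Injective (Matrix.GeneralLinearGroup.map (n := n) f) := by
    intro a b hab
    ext i j
    have := congrArg (fun z : GL n S => z.val i j) hab
    exact hf (by simpa using this)
  rw [injective_iff_map_eq_one]
  intro x hx
  induction x using Matrix.ProjGenLinGroup.induction_on with
  | mk g =>
    rw [Matrix.ProjGenLinGroup.map_mk, Matrix.ProjGenLinGroup.mk_eq_one,
      Subgroup.mem_center_iff] at hx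
    rw [Matrix.ProjGenLinGroup.mk_eq_one, Subgroup.mem_center_iff]
    exact fun h => hinj (by rw [map_mul, map_mul, hx])

theorem pslMap_injective : Function.Injective pslMap := by
  have h : Function.Injective (Matrix.ProjectiveSpecialLinearGroup.toPGL ∘ pslMap) := by
    have : Matrix.ProjectiveSpecialLinearGroup.toPGL ∘ pslMap =
        Matrix.ProjGenLinGroup.map (n := Fin 2) embC ∘ Matrix.ProjectiveSpecialLinearGroup.toPGL :=
      funext toPGL_pslMap
    rw [this]
    exact (projGenLinGroup_map_injective embC_injective).comp
      Matrix.ProjectiveSpecialLinearGroup.toPGL_injective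
  exact h.of_comp

theorem matA_eq : matA = Matrix.SpecialLinearGroup.map embC (lower ⟨0, -1⟩) := by
  rw [map_lower]
  ext i j; fin_cases i <;> fin_cases j <;> simp [matA, embC_apply]

theorem matW_eq : matW = Matrix.SpecialLinearGroup.map embC (lower ⟨-1, -1⟩) := by
  rw [map_lower]
  ext i j; fin_cases i <;> fin_cases j <;> simp [matW, embC_apply]; ring

theorem matU_eq : matU =
    Matrix.SpecialLinearGroup.map embC (lower 1 * rot⁻¹ * lower ⟨-1, 1⟩) := by
  rw [map_mul, map_mul, map_inv, map_lower, map_lower, map_rot]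
  ext i j
  fin_cases i <;> fin_cases j <;> simp [matU, embC_apply, Matrix.mul_apply] <;> ring

theorem matV_eq : ∃ g : SL(2, ℤ√3), matV = Matrix.SpecialLinearGroup.map embC g := by
  refine ⟨⟨!![⟨-1, 2⟩, 1; ⟨-8, 3⟩, ⟨1, -1⟩], by rw [Matrix.det_fin_two_of]; rfl⟩, ?_⟩
  ext i j
  change _ = embC _
  fin_cases i <;> fin_cases j <;> simp [matV, embC_apply]; ring

/-- Only A, W and U are needed; V and G play no role here. -/
theorem range_pslMap_le : pslMap.range ≤ monodromyGroup := by
  set K : Subgroup SL(2, ℤ√3) :=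
    monodromyGroup.comap (toPSL.comp (Matrix.SpecialLinearGroup.map embC)) with hK
  have hA : lower ⟨0, -1⟩ ∈ K := by
    rw [hK, Subgroup.mem_comap, MonoidHom.comp_apply, ← matA_eq]
    exact Subgroup.subset_closure (by simp)
  have hW : lower ⟨-1, -1⟩ ∈ K := by
    rw [hK, Subgroup.mem_comap, MonoidHom.comp_apply, ← matW_eq]
    exact Subgroup.subset_closure (by simp)
  have hU : lower 1 * rot⁻¹ * lower ⟨-1, 1⟩ ∈ K := by
    rw [hK, Subgroup.mem_comap, MonoidHom.comp_apply, ← matU_eq]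
    exact Subgroup.subset_closure (by simp)
  let L : AddSubgroup (ℤ√3) :=
    { carrier := {x | lower x ∈ K}
      zero_mem' := by simp [lower_zero]
      add_mem' := fun {x y} hx hy => by
        rw [Set.mem_ofPred_eq, lower_add]; exact K.mul_mem hx hy
      neg_mem' := fun {x} hx => by rw [Set.mem_ofPred_eq, lower_neg]; exact K.inv_mem hx }
  have hlow : ∀ x, lower x ∈ K := fun x => by
    -- Coordinates of `x` in the ℤ-basis given by the lower left entries of W and A.
    have h : x = (-x.re) • (⟨-1, -1⟩ : ℤ√3) + (x.re - x.im) • (⟨0, -1⟩ : ℤ√3) := by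
      ext <;> simp
    change x ∈ L
    rw [h]
    exact L.add_mem (L.zsmul_mem hW _) (L.zsmul_mem hA _)
  have hrot : rot ∈ K := by
    rw [Subgroup.mul_mem_cancel_right K (hlow _), Subgroup.mul_mem_cancel_left K (hlow _)] at hU
    exact inv_mem_iff.1 hU
  have htop := eq_top_of_lower_mem K hrot hlow
  rintro _ ⟨x, rfl⟩
  induction x using QuotientGroup.induction_on with
  | H g => exact (htop ▸ Subgroup.mem_top g : g ∈ K)

/-- The matrix with entries in `ℤ[√3]` proportional to `G`. -/
def matGInt : GL (Fin 2) (ℤ√3) :=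
  ⟨!![⟨-1, 1⟩, 1; ⟨-7, 4⟩, ⟨2, -1⟩], fundUnit • !![⟨2, -1⟩, -1; ⟨7, -4⟩, ⟨-1, 1⟩],
    by ext i j : 2 <;> fin_cases i <;> fin_cases j <;> simp [Matrix.mul_apply] <;> rfl,
    by ext i j : 2 <;> fin_cases i <;> fin_cases j <;> simp [Matrix.mul_apply] <;> rfl⟩

theorem det_matGInt : matGInt.val.det = ⟨2, -1⟩ := by
  rw [matGInt, Matrix.det_fin_two_of]; rfl

theorem fundUnit_mul_det_matGInt : fundUnit * matGInt.val.det = 1 := by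
  rw [det_matGInt]; rfl

theorem matGInt_mem : matGInt ∈ GLTotPos := by
  have h1 : (1 : ℝ) ≤ √3 := Real.one_le_sqrt.2 (by norm_num)
  have h2 : √(3 : ℝ) < 2 := (Real.sqrt_lt' (by norm_num)).2 (by norm_num)
  change TotallyPositive matGInt.val.det
  rw [det_matGInt]
  constructor
  · rw [embOne_apply]; push_cast; linarith
  · rw [embTwo_apply]; push_cast; linarith

theorem toPGL_matG : Matrix.ProjectiveSpecialLinearGroup.toPGL (toPSL matG) =
    Matrix.ProjGenLinGroup.map embC (Matrix.ProjGenLinGroup.mk matGInt) := by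
  rw [toPSL, QuotientGroup.mk'_apply, Matrix.ProjectiveSpecialLinearGroup.toPGL_mk,
    Matrix.ProjGenLinGroup.map_mk, Matrix.ProjGenLinGroup.mk_eq_mk_iff]
  -- The scalar taking G to its integral multiple; its square is 2 - √3, the determinant of
  -- `matGInt`.
  refine ⟨⟨sqrtTwo / 2 * (sqrtThree - 1), sqrtTwo / 2 * (sqrtThree + 1), ?_, ?_⟩, ?_⟩
  · linear_combination (sqrtThree ^ 2 - 1) / 4 * sqrtTwo_sq + 1 / 2 * sqrtThree_sq
  · linear_combination (sqrtThree ^ 2 - 1) / 4 * sqrtTwo_sq + 1 / 2 * sqrtThree_sq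
  · ext i j
    rw [Units.val_mul, Matrix.GeneralLinearGroup.coe_scalar,
      Matrix.SpecialLinearGroup.coe_GL_coe_matrix]
    fin_cases i <;> fin_cases j <;>
      simp [matG, matGInt, embC_apply, Matrix.mul_apply]
    · linear_combination (sqrtThree - 1) / 2 * sqrtTwo_sq
    · linear_combination (sqrtThree ^ 2 - 1) / 4 * sqrtTwo_sq + 1 / 2 * sqrtThree_sq
    · linear_combination (5 - 3 * sqrtThree) * (sqrtThree - 1) / 4 * sqrtTwo_sq
        - 3 / 2 * sqrtThree_sq
    · linear_combination (sqrtThree - 1) ^ 2 / 4 * sqrtTwo_sq + 1 / 2 * sqrtThree_sq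

theorem toPGL_toPSL_map_mem (g : SL(2, ℤ√3)) :
    Matrix.ProjectiveSpecialLinearGroup.toPGL (toPSL (Matrix.SpecialLinearGroup.map embC g)) ∈
      PGLTotPos.map (Matrix.ProjGenLinGroup.map (n := Fin 2) embC) := by
  rw [← pslMap_toPSL, toPGL_pslMap]
  refine ⟨_, ⟨Matrix.SpecialLinearGroup.toGL g, ?_, rfl⟩, rfl⟩
  change TotallyPositive g.val.det
  rw [g.det_coe]; exact TotallyPositive.one

theorem map_monodromyGroup_le : monodromyGroup.map Matrix.ProjectiveSpecialLinearGroup.toPGL ≤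
    PGLTotPos.map (Matrix.ProjGenLinGroup.map (n := Fin 2) embC) := by
  rw [Subgroup.map_le_iff_le_comap, monodromyGroup, Subgroup.closure_le]
  rintro x (rfl | rfl | rfl | rfl | rfl)
  · rw [matU_eq]; exact toPGL_toPSL_map_mem _
  · obtain ⟨g, hg⟩ := matV_eq
    rw [hg]; exact toPGL_toPSL_map_mem _
  · rw [matW_eq]; exact toPGL_toPSL_map_mem _
  · rw [matA_eq]; exact toPGL_toPSL_map_mem _
  · rw [SetLike.mem_coe, Subgroup.mem_comap, toPGL_matG]
    exact ⟨_, ⟨matGInt, matGInt_mem, rfl⟩, rfl⟩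

/-- The class of a matrix whose determinant is a square comes from `PSL₂`. -/
theorem exists_toPGL_eq_of_det_eq_sq {R : Type*} [CommRing R] (M : GL (Fin 2) R) (v : Rˣ)
    (hv : M.val.det = v ^ 2) :
    ∃ x : PSL(2, R), Matrix.ProjectiveSpecialLinearGroup.toPGL x = Matrix.ProjGenLinGroup.mk M := by
  let g : SL(2, R) := ⟨(↑v⁻¹ : R) • M.val, by
    rw [Matrix.det_smul, hv, Fintype.card_fin, ← mul_pow, Units.inv_mul, one_pow]⟩
  have hg : g.val = (↑v⁻¹ : R) • M.val := rfl
  refine ⟨QuotientGroup.mk g, ?_⟩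
  · rw [Matrix.ProjectiveSpecialLinearGroup.toPGL_mk, Matrix.ProjGenLinGroup.mk_eq_mk_iff]
    refine ⟨v, ?_⟩
    ext i j
    rw [Units.val_mul, Matrix.GeneralLinearGroup.coe_scalar,
      Matrix.SpecialLinearGroup.coe_GL_coe_matrix, hg]
    fin_cases i <;> fin_cases j <;> simp [Matrix.mul_apply, mul_comm _ (v : R)]

/-- The determinant is a square or ε times a square; in the second case multiplying by `matGInt`, of
determinant ε⁻¹, makes it a square. -/
theorem exists_toPGL_eq_or {M : GL (Fin 2) (ℤ√3)} (hM : M ∈ GLTotPos) :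
    (∃ x : PSL(2, ℤ√3), Matrix.ProjectiveSpecialLinearGroup.toPGL x =
      Matrix.ProjGenLinGroup.mk M) ∨
    (∃ x : PSL(2, ℤ√3), Matrix.ProjectiveSpecialLinearGroup.toPGL x =
      Matrix.ProjGenLinGroup.mk M * Matrix.ProjGenLinGroup.mk matGInt) := by
  have hu : IsUnit M.val.det := (Matrix.isUnit_iff_isUnit_det _).1 M.isUnit
  obtain ⟨v, hv | hv⟩ := exists_sq_eq_of_totallyPositive hu hM
  · exact Or.inl (exists_toPGL_eq_of_det_eq_sq M v hv)
  · rw [← map_mul]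
    refine Or.inr (exists_toPGL_eq_of_det_eq_sq _ v ?_)
    rw [Units.val_mul, Matrix.det_mul, hv, mul_right_comm, fundUnit_mul_det_matGInt, one_mul]

theorem toPSL_matG_mem : toPSL matG ∈ monodromyGroup := Subgroup.subset_closure (by simp)

theorem le_map_monodromyGroup : PGLTotPos.map (Matrix.ProjGenLinGroup.map (n := Fin 2) embC) ≤
    monodromyGroup.map Matrix.ProjectiveSpecialLinearGroup.toPGL := by
  have hpsl : ∀ x : PSL(2, ℤ√3),
      Matrix.ProjGenLinGroup.map embC (Matrix.ProjectiveSpecialLinearGroup.toPGL x) ∈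
        monodromyGroup.map Matrix.ProjectiveSpecialLinearGroup.toPGL := fun x => by
    rw [← toPGL_pslMap]
    exact Subgroup.mem_map_of_mem _ (range_pslMap_le ⟨x, rfl⟩)
  rintro _ ⟨_, ⟨M, hM, rfl⟩, rfl⟩
  obtain ⟨x, hx⟩ | ⟨x, hx⟩ := exists_toPGL_eq_or hM
  · rw [← hx]; exact hpsl x
  · have h := hpsl x
    rw [hx, map_mul, ← toPGL_matG] at h
    exact (Subgroup.mul_mem_cancel_right _ (Subgroup.mem_map_of_mem _ toPSL_matG_mem)).1 h

/-- Otherwise the upper left entry √2 would be, up to a scalar of square one, in `ℤ√3`, and 2 would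
be a square there. Rational parts then give m² + 3n² = 2, which has no integral solution. -/
theorem toPSL_matG_notMem : toPSL matG ∉ pslMap.range := by
  rintro ⟨x, hx⟩
  induction x using QuotientGroup.induction_on with
  | H g =>
    rw [pslMap_toPSL, toPSL, QuotientGroup.mk'_apply, QuotientGroup.mk'_apply,
      QuotientGroup.eq, Matrix.SpecialLinearGroup.mem_center_iff] at hx
    obtain ⟨r, hr, h⟩ := hx
    rw [Fintype.card_fin] at hr
    have h1 : Matrix.SpecialLinearGroup.map embC g * ((Matrix.SpecialLinearGroup.map embC g)⁻¹ *
      matG) = matG := mul_inv_cancel_left _ _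
    have h2 := congrArg (fun z : SL(2, ℂ) => z.val 0 0) h1
    simp only [Matrix.SpecialLinearGroup.coe_mul _ ((Matrix.SpecialLinearGroup.map embC g)⁻¹ *
      matG), ← h] at h2
    have h3 : embC (g 0 0) * r = sqrtTwo := by simpa [matG] using h2
    have h4 : embC (g 0 0 ^ 2) = embC 2 := by
      rw [map_pow, map_ofNat, ← sqrtTwo_sq, ← h3, mul_pow, hr, mul_one]
    have h5 := embC_injective h4
    have h6 := congrArg Zsqrtd.re h5
    have h7 : (g 0 0).re ^ 2 + 3 * (g 0 0).im ^ 2 = 2 := by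
      simpa [pow_two, mul_assoc] using h6
    have h8 : (g 0 0).im = 0 := by
      by_contra h0
      have : 0 < (g 0 0).im ^ 2 := by positivity
      nlinarith [sq_nonneg (g 0 0).re]
    rw [h8] at h7
    have h9 : (g 0 0).re < 2 := by nlinarith
    have h10 : -2 < (g 0 0).re := by nlinarith
    generalize (g 0 0).re = n at *
    interval_cases n <;> omega

theorem relIndex_range_pslMap : pslMap.range.relIndex monodromyGroup = 2 := by
  rw [Subgroup.relIndex, Subgroup.index_eq_two_iff]
  refine ⟨⟨toPSL matG, toPSL_matG_mem⟩, fun ⟨b, hb⟩ => ?_⟩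
  simp only [Subgroup.mem_subgroupOf, Subgroup.coe_mul]
  obtain ⟨_, ⟨M, hM, rfl⟩, hMb⟩ := map_monodromyGroup_le (Subgroup.mem_map_of_mem _ hb)
  obtain ⟨x, hx⟩ | ⟨x, hx⟩ := exists_toPGL_eq_or hM
  · have hbx : b ∈ pslMap.range := ⟨x, Matrix.ProjectiveSpecialLinearGroup.toPGL_injective
      (by rw [toPGL_pslMap, hx, hMb])⟩
    exact Or.inr ⟨hbx, fun h => toPSL_matG_notMem ((Subgroup.mul_mem_cancel_left _ hbx).1 h)⟩
  · have hbx : b * toPSL matG ∈ pslMap.range :=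
      ⟨x, Matrix.ProjectiveSpecialLinearGroup.toPGL_injective
        (by rw [toPGL_pslMap, hx, map_mul, map_mul, hMb, toPGL_matG])⟩
    exact Or.inl ⟨hbx, fun h => toPSL_matG_notMem ((Subgroup.mul_mem_cancel_left _ h).1 hbx)⟩

/-! ### The usual embedding and the Hurwitz–Maass extension -/

theorem usualEmbedding_injective : Function.Injective usualEmbedding := by
  intro a b hab
  have h := congrArg (fun z : PGLPosReal × PGLPosReal => z.1.val) hab
  exact Subtype.ext (projGenLinGroup_map_injective embOne_injective h)

theorem mem_range_usualEmbedding_iff {x : PGLPosReal × PGLPosReal} :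
    x ∈ usualEmbedding.range ↔ ∃ M ∈ GLTotPos,
      x.1.val = Matrix.ProjGenLinGroup.mk (Matrix.GeneralLinearGroup.map embOne M) ∧
      x.2.val = Matrix.ProjGenLinGroup.mk (Matrix.GeneralLinearGroup.map embTwo M) := by
  constructor
  · rintro ⟨⟨_, ⟨M, hM, rfl⟩⟩, rfl⟩
    exact ⟨M, hM, rfl, rfl⟩
  · rintro ⟨M, hM, h1, h2⟩
    exact ⟨⟨_, ⟨M, hM, rfl⟩⟩, Prod.ext (Subtype.ext h1.symm) (Subtype.ext h2.symm)⟩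

theorem isHurwitzMaass_of_mem {M : GL (Fin 2) (ℤ√3)} (hM : M ∈ GLTotPos) :
    IsHurwitzMaass M.val := by
  have hu : IsUnit M.val.det := (Matrix.isUnit_iff_isUnit_det _).1 M.isUnit
  refine ⟨hM, ?_⟩
  rw [Ideal.span_singleton_eq_top.2 hu]
  exact Ideal.eq_top_of_isUnit_mem _ (det_mem_contentIdeal_sq _) hu

/-- A matrix of Hurwitz–Maass type is a multiple of a matrix in `GL₂⁺(ℤ[√3])`. -/
theorem IsHurwitzMaass.exists_smul {M : Matrix (Fin 2) (Fin 2) (ℤ√3)} (hM : IsHurwitzMaass M) :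
    ∃ c : ℤ√3, c ≠ 0 ∧ ∃ N ∈ GLTotPos, M = c • N.val := by
  obtain ⟨c, hc⟩ := (IsPrincipalIdealRing.principal (contentIdeal M)).principal
  rw [Ideal.submodule_span_eq] at hc
  have hdvd : ∀ i j, c ∣ M i j := fun i j =>
    Ideal.mem_span_singleton.1 (hc ▸ entry_mem_contentIdeal M i j)
  choose N hN using hdvd
  have hMN : M = c • Matrix.of N := Matrix.ext hN
  have hdet : M.det = c ^ 2 * (Matrix.of N).det := by rw [hMN, Matrix.det_smul, Fintype.card_fin]
  have hdet0 : M.det ≠ 0 := fun h => by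
    have := hM.1.1
    rw [h, map_zero] at this
    exact lt_irrefl _ this
  have hc0 : c ≠ 0 := by
    rintro rfl
    simp [hdet] at hdet0
  have h2 := hM.2
  -- Now c² and det M = c² det N generate the same ideal, so det N is a unit.
  rw [hc, Ideal.span_singleton_pow, Ideal.span_singleton_eq_span_singleton] at h2
  have hu : IsUnit (Matrix.of N).det := by
    obtain ⟨u, hu⟩ := h2
    rw [hdet] at hu
    rw [← mul_left_cancel₀ (pow_ne_zero 2 hc0) hu]
    exact u.isUnit
  refine ⟨c, hc0, Matrix.GeneralLinearGroup.mk'' _ hu, ?_, hMN⟩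
  have hp := hM.1
  rw [TotallyPositive, hdet, map_mul, map_mul, map_pow, map_pow] at hp
  exact ⟨pos_of_mul_pos_right hp.1 (sq_nonneg _), pos_of_mul_pos_right hp.2 (sq_nonneg _)⟩

theorem range_usualEmbedding : usualEmbedding.range = hurwitzMaass := by
  ext x
  rw [mem_range_usualEmbedding_iff]
  constructor
  · rintro ⟨M, hM, h1, h2⟩
    exact ⟨M.val, _, _, isHurwitzMaass_of_mem hM, rfl, rfl, h1, h2⟩
  · rintro ⟨M, g₁, g₂, hM, hg1, hg2, h1, h2⟩
    obtain ⟨c, hc, N, hN, rfl⟩ := hM.exists_smul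
    have key : ∀ (f : ℤ√3 →+* ℝ) (hf : f c ≠ 0) (g : GL (Fin 2) ℝ),
        g.val = (c • N.val).map f → Matrix.ProjGenLinGroup.mk g =
          Matrix.ProjGenLinGroup.mk (Matrix.GeneralLinearGroup.map f N) := by
      intro f hf g hg
      rw [eq_comm, Matrix.ProjGenLinGroup.mk_eq_mk_iff]
      refine ⟨Units.mk0 _ hf, ?_⟩
      ext i j
      rw [hg, Units.val_mul, Matrix.GeneralLinearGroup.coe_scalar]
      fin_cases i <;> fin_cases j <;> simp [Matrix.mul_apply, mul_comm]
    exact ⟨N, hN, h1.trans (key _ ((map_ne_zero_iff _ embOne_injective).2 hc) _ hg1),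
      h2.trans (key _ ((map_ne_zero_iff _ embTwo_injective).2 hc) _ hg2)⟩

/-! ### Discreteness -/

instance isTopologicalGroupPGL : IsTopologicalGroup PGL(2, ℝ) :=
  inferInstanceAs (IsTopologicalGroup (GL (Fin 2) ℝ ⧸ Subgroup.center (GL (Fin 2) ℝ)))

theorem continuous_mk :
    Continuous (Matrix.ProjGenLinGroup.mk : GL (Fin 2) ℝ → PGL(2, ℝ)) :=
  continuous_coinduced_rng

/-- The real matrices close to scalar matrices, up to scaling. -/
def nearScalar : Set (GL (Fin 2) ℝ) :=
  {g | |g.val 0 1 ^ 2 / g.val.det| < 1 ∧ |g.val 1 0 ^ 2 / g.val.det| < 1 ∧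
    |(g.val 0 0 - g.val 1 1) ^ 2 / g.val.det| < 1}

theorem isOpen_nearScalar : IsOpen nearScalar := by
  have hc : ∀ i j, Continuous fun g : GL (Fin 2) ℝ => g.val i j := fun i j =>
    Units.continuous_val.matrix_elem i j
  have hd : Continuous fun g : GL (Fin 2) ℝ => g.val.det := Units.continuous_val.matrix_det
  have hd0 : ∀ g : GL (Fin 2) ℝ, g.val.det ≠ 0 := fun g =>
    ((Matrix.isUnit_iff_isUnit_det _).1 g.isUnit).ne_zero
  have key : ∀ f : GL (Fin 2) ℝ → ℝ, Continuous f → IsOpen {g | |f g ^ 2 / g.val.det| < 1} :=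
    fun f hf => isOpen_lt ((hf.pow 2).div hd hd0).abs continuous_const
  exact (key _ (hc 0 1)).inter ((key _ (hc 1 0)).inter (key _ ((hc 0 0).sub (hc 1 1))))

theorem mul_scalar_mem_nearScalar {g : GL (Fin 2) ℝ} (u : ℝˣ) (hg : g ∈ nearScalar) :
    g * Matrix.GeneralLinearGroup.scalar (Fin 2) u ∈ nearScalar := by
  have hv : (g * Matrix.GeneralLinearGroup.scalar (Fin 2) u).val = (u : ℝ) • g.val := by
    rw [Units.val_mul, Matrix.GeneralLinearGroup.coe_scalar]
    ext i j
    fin_cases i <;> fin_cases j <;> simp [Matrix.mul_apply, mul_comm]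
  have hq : ∀ x : ℝ, ((u : ℝ) * x) ^ 2 / ((u : ℝ) ^ 2 * g.val.det) = x ^ 2 / g.val.det :=
    fun x => by rw [mul_pow, mul_div_mul_left _ _ (pow_ne_zero 2 u.ne_zero)]
  simp only [nearScalar, Set.mem_ofPred_eq, hv, Matrix.det_smul, Fintype.card_fin,
    Matrix.smul_apply, smul_eq_mul, ← mul_sub, hq]
  exact hg

/-- The classes of the matrices close to scalar matrices. -/
def nearOne : Set PGL(2, ℝ) := Matrix.ProjGenLinGroup.mk '' nearScalar

/-- The conditions defining `nearScalar` are homogeneous of degree zero, so this open set is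
saturated for the quotient map. -/
theorem mk_mem_nearOne_iff {g : GL (Fin 2) ℝ} :
    Matrix.ProjGenLinGroup.mk g ∈ nearOne ↔ g ∈ nearScalar := by
  refine ⟨?_, fun h => ⟨g, h, rfl⟩⟩
  rintro ⟨k, hk, h⟩
  obtain ⟨u, rfl⟩ := Matrix.ProjGenLinGroup.mk_eq_mk_iff.1 h
  exact mul_scalar_mem_nearScalar u hk

theorem isOpen_nearOne : IsOpen nearOne := by
  rw [isOpen_coinduced]
  convert isOpen_nearScalar
  ext g
  exact mk_mem_nearOne_iff

theorem mk_eq_one_of_mem_nearScalar {M : GL (Fin 2) (ℤ√3)}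
    (h1 : Matrix.GeneralLinearGroup.map embOne M ∈ nearScalar)
    (h2 : Matrix.GeneralLinearGroup.map embTwo M ∈ nearScalar) :
    Matrix.ProjGenLinGroup.mk M = 1 := by
  obtain ⟨d, hd⟩ := (Matrix.isUnit_iff_isUnit_det _).1 M.isUnit
  -- As the determinant is a unit, x² / det is again in `ℤ√3`, with both conjugates small, hence
  -- zero. Applied to the off-diagonal entries and to the difference of the diagonal ones, this
  -- makes M scalar.
  have key : ∀ x : ℤ√3, |embOne x ^ 2 / embOne d| < 1 → |embTwo x ^ 2 / embTwo d| < 1 → x = 0 := by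
    intro x hx1 hx2
    have hf : ∀ f : ℤ√3 →+* ℝ, f (x ^ 2 * (↑d⁻¹ : ℤ√3)) = f x ^ 2 / f d := by
      intro f
      have hfd : f d * f (↑d⁻¹ : ℤ√3) = 1 := by rw [← map_mul, Units.mul_inv, map_one]
      rw [map_mul, map_pow, eq_div_iff (left_ne_zero_of_mul_eq_one hfd)]
      linear_combination f x ^ 2 * hfd
    have h0 := eq_zero_of_abs_emb_lt_one (x := x ^ 2 * (↑d⁻¹ : ℤ√3)) (by rwa [hf]) (by rwa [hf])
    simpa using h0
  simp only [nearScalar, Set.mem_ofPred_eq, Matrix.GeneralLinearGroup.map_apply,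
    ← Matrix.GeneralLinearGroup.val_det_apply, Matrix.GeneralLinearGroup.map_det,
    Units.coe_map, MonoidHom.coe_coe, ← map_sub] at h1 h2
  simp only [Matrix.GeneralLinearGroup.val_det_apply, ← hd] at h1 h2
  have h01 := key _ h1.1 h2.1
  have h10 := key _ h1.2.1 h2.2.1
  have h00 := key _ h1.2.2 h2.2.2
  rw [Matrix.det_fin_two, h01, zero_mul, sub_zero] at hd
  have hu : IsUnit (M.val 0 0) := isUnit_of_mul_isUnit_left (hd ▸ d.isUnit)
  rw [← map_one Matrix.ProjGenLinGroup.mk, eq_comm, Matrix.ProjGenLinGroup.mk_eq_mk_iff]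
  refine ⟨hu.unit, ?_⟩
  refine Units.ext (Matrix.ext fun i j => ?_)
  rw [one_mul, Matrix.GeneralLinearGroup.coe_scalar]
  fin_cases i <;> fin_cases j <;> simp [h01, h10, ← sub_eq_zero.1 h00]

theorem discreteTopology_range_usualEmbedding : DiscreteTopology usualEmbedding.range := by
  apply discreteTopology_of_isOpen_singleton_one
  have hopen : IsOpen {x : usualEmbedding.range | x.1.1.1 ∈ nearOne ∧ x.1.2.1 ∈ nearOne} :=
    (isOpen_nearOne.preimage (continuous_subtype_val.comp
      (continuous_fst.comp continuous_subtype_val))).inter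
    (isOpen_nearOne.preimage (continuous_subtype_val.comp
      (continuous_snd.comp continuous_subtype_val)))
  convert hopen
  ext ⟨x, hx⟩
  rw [Set.mem_singleton_iff, Set.mem_ofPred_eq]
  constructor
  · intro h
    have h1 : (1 : PGL(2, ℝ)) ∈ nearOne := by
      rw [← map_one Matrix.ProjGenLinGroup.mk, mk_mem_nearOne_iff]
      simp [nearScalar]
    rw [h]
    exact ⟨h1, h1⟩
  · rintro ⟨h1, h2⟩
    obtain ⟨M, hM, hM1, hM2⟩ := mem_range_usualEmbedding_iff.1 hx
    simp only [hM1, hM2, mk_mem_nearOne_iff] at h1 h2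
    have h := mk_eq_one_of_mem_nearScalar h1 h2
    rw [← Matrix.ProjGenLinGroup.map_mk, h, map_one] at hM1 hM2
    exact Subtype.ext (Prod.ext (Subtype.ext hM1) (Subtype.ext hM2))

/-! ### Coverings by `SL₂(ℝ × ℝ)` -/

/-- The pair of real embeddings of `ℤ[√3]`. -/
noncomputable def emb : ℤ√3 →+* ℝ × ℝ := embOne.prod embTwo

/-- The projection `SL₂(ℝ × ℝ) → PGL₂⁺(ℝ)` attached to a homomorphism `ℝ × ℝ → ℝ`. -/
noncomputable def projFactor (f : ℝ × ℝ →+* ℝ) : SL(2, ℝ × ℝ) →* PGLPosReal :=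
  (Matrix.SpecialLinearGroup.toPGL.comp (Matrix.SpecialLinearGroup.map f)).codRestrict PGLPosReal
    fun g => ⟨Matrix.SpecialLinearGroup.toGL (Matrix.SpecialLinearGroup.map f g), by
      rw [SetLike.mem_coe, Matrix.mem_glpos, Matrix.GeneralLinearGroup.val_det_apply,
        Matrix.SpecialLinearGroup.coe_GL_coe_matrix, Matrix.SpecialLinearGroup.det_coe]
      exact one_pos, rfl⟩

/-- The projection `SL₂(ℝ × ℝ) = SL₂(ℝ)² → PGL₂⁺(ℝ)²`. -/
noncomputable def proj : SL(2, ℝ × ℝ) →* PGLPosReal × PGLPosReal :=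
  (projFactor (RingHom.fst ℝ ℝ)).prod (projFactor (RingHom.snd ℝ ℝ))

theorem continuous_proj : Continuous proj := by
  have h : ∀ f : ℝ × ℝ →+* ℝ, Continuous f → Continuous (projFactor f) := fun f hf =>
    (continuous_mk.comp (Matrix.SpecialLinearGroup.continuous_toGL.comp
      hf.specialLinearGroup_map)).subtype_mk _
  exact (h _ continuous_fst).prodMk (h _ continuous_snd)

theorem exists_toPGL_eq_of_mem {x : PGL(2, ℝ)} (hx : x ∈ PGLPosReal) :
    ∃ g : SL(2, ℝ), Matrix.SpecialLinearGroup.toPGL g = x := by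
  obtain ⟨M, hM, rfl⟩ := hx
  have hM' : 0 < M.val.det := hM
  obtain ⟨y, hy⟩ := exists_toPGL_eq_of_det_eq_sq M (Units.mk0 _ (Real.sqrt_pos.2 hM').ne')
    (by rw [Units.val_mk0, Real.sq_sqrt hM'.le])
  induction y using QuotientGroup.induction_on with
  | H g => exact ⟨g, hy⟩

theorem proj_surjective : Function.Surjective proj := by
  rintro ⟨⟨x, hx⟩, ⟨y, hy⟩⟩
  obtain ⟨g, rfl⟩ := exists_toPGL_eq_of_mem hx
  obtain ⟨k, rfl⟩ := exists_toPGL_eq_of_mem hy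
  refine ⟨⟨Matrix.of fun i j => (g i j, k i j), ?_⟩, ?_⟩
  · rw [Matrix.det_fin_two]
    exact Prod.ext (det_entries g) (det_entries k)
  · exact Prod.ext (Subtype.ext (congrArg Matrix.SpecialLinearGroup.toPGL
      (Matrix.SpecialLinearGroup.ext _ _ fun i j => rfl)))
      (Subtype.ext (congrArg Matrix.SpecialLinearGroup.toPGL
      (Matrix.SpecialLinearGroup.ext _ _ fun i j => rfl)))

theorem exists_sq_eq_one_of_toPGL_eq {R : Type*} [CommRing R] {s t : SL(2, R)}
    (h : Matrix.SpecialLinearGroup.toPGL s = Matrix.SpecialLinearGroup.toPGL t) :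
    ∃ r : R, r ^ 2 = 1 ∧ ∀ i j, t.val i j = r * s.val i j := by
  obtain ⟨u, hu⟩ := Matrix.ProjGenLinGroup.mk_eq_mk_iff.1 h
  have hv : ∀ i j, t.val i j = u * s.val i j := fun i j => by
    have := congrArg (fun z : GL (Fin 2) R => z.val i j) hu
    simp only [Units.val_mul, Matrix.GeneralLinearGroup.coe_scalar,
      Matrix.SpecialLinearGroup.coe_GL_coe_matrix] at this
    rw [← this]
    fin_cases i <;> fin_cases j <;> simp [Matrix.mul_apply, mul_comm]
  refine ⟨u, ?_, hv⟩
  have h1 := det_entries t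
  rw [hv, hv, hv, hv] at h1
  linear_combination h1 - (u : R) ^ 2 * det_entries s

/-- Two elements with the same projection differ by a scalar of square one. -/
theorem exists_sq_eq_one_of_proj_eq {s t : SL(2, ℝ × ℝ)} (h : proj s = proj t) :
    ∃ r : ℝ × ℝ, r ^ 2 = 1 ∧ ∀ i j, t.val i j = r * s.val i j := by
  obtain ⟨r₁, h1, hr1⟩ := exists_sq_eq_one_of_toPGL_eq
    (congrArg (fun z : PGLPosReal × PGLPosReal => z.1.val) h)
  obtain ⟨r₂, h2, hr2⟩ := exists_sq_eq_one_of_toPGL_eq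
    (congrArg (fun z : PGLPosReal × PGLPosReal => z.2.val) h)
  exact ⟨(r₁, r₂), Prod.ext h1 h2, fun i j => Prod.ext (hr1 i j) (hr2 i j)⟩

theorem proj_map_emb_mem (g : SL(2, ℤ√3)) :
    proj (Matrix.SpecialLinearGroup.map emb g) ∈ usualEmbedding.range := by
  refine mem_range_usualEmbedding_iff.2 ⟨Matrix.SpecialLinearGroup.toGL g, ?_, ?_, ?_⟩
  · change TotallyPositive g.val.det
    rw [g.det_coe]; exact TotallyPositive.one
  · exact congrArg Matrix.ProjGenLinGroup.mk (Units.ext (Matrix.ext fun i j => rfl))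
  · exact congrArg Matrix.ProjGenLinGroup.mk (Units.ext (Matrix.ext fun i j => rfl))

/-- The diagonal matrix whose entry ratio is a totally positive unit belongs to the extended
modular group. -/
theorem proj_diag_mem {u : ℤ√3} (hu : IsUnit u) (hp : TotallyPositive u) {a d : ℝ × ℝ}
    (h : a * d = 1) (ha : a ^ 2 = emb u) : proj (diag a d h) ∈ usualEmbedding.range := by
  obtain ⟨u, rfl⟩ := hu
  let M : GL (Fin 2) (ℤ√3) := ⟨!![(u : ℤ√3), 0; 0, 1], !![(↑u⁻¹ : ℤ√3), 0; 0, 1],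
    by simp [Matrix.one_fin_two],
    by simp [Matrix.one_fin_two]⟩
  have hM : M.val = !![(u : ℤ√3), 0; 0, 1] := rfl
  have key : ∀ (f : ℝ × ℝ →+* ℝ) (f' : ℤ√3 →+* ℝ), f (emb u) = f' u →
      Matrix.SpecialLinearGroup.toPGL (Matrix.SpecialLinearGroup.map f (diag a d h)) =
        Matrix.ProjGenLinGroup.mk (Matrix.GeneralLinearGroup.map f' M) := by
    intro f f' hf
    have hfad : f a * f d = 1 := by rw [← map_mul, h, map_one]
    refine Matrix.ProjGenLinGroup.mk_eq_mk_iff.2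
      ⟨⟨f a, f d, hfad, by rw [mul_comm, hfad]⟩, ?_⟩
    ext i j
    rw [Units.val_mul, Matrix.GeneralLinearGroup.coe_scalar,
      Matrix.SpecialLinearGroup.coe_GL_coe_matrix, Matrix.GeneralLinearGroup.map_apply, hM]
    fin_cases i <;> fin_cases j <;> simp [Matrix.mul_apply, ← hf, ← ha, pow_two, mul_comm _ (f a),
      hfad]
  refine mem_range_usualEmbedding_iff.2 ⟨M, ?_, key _ _ rfl, key _ _ rfl⟩
  change TotallyPositive M.val.det
  rw [hM, Matrix.det_fin_two_of]
  simpa using hp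

/-! ### The lattice `ℤ[√3]` in `ℝ × ℝ` -/

theorem emb_injective : Function.Injective emb := fun _ _ h =>
  embOne_injective (congrArg Prod.fst h)

theorem exists_mul_eq_one {x : ℝ × ℝ} (h1 : x.1 ≠ 0) (h2 : x.2 ≠ 0) : ∃ y, x * y = 1 :=
  ⟨(x.1⁻¹, x.2⁻¹), Prod.ext (mul_inv_cancel₀ h1) (mul_inv_cancel₀ h2)⟩

theorem exists_emb_mul_eq_one {m : ℤ√3} (hm : m ≠ 0) : ∃ y, emb m * y = 1 :=
  exists_mul_eq_one ((map_ne_zero_iff _ embOne_injective).2 hm)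
    ((map_ne_zero_iff _ embTwo_injective).2 hm)

/-- Every point of `ℝ × ℝ` lies at bounded distance from the lattice `ℤ[√3]`. -/
theorem exists_norm_sub_emb_le (x : ℝ × ℝ) : ∃ q : ℤ√3, ‖x - emb q‖ ≤ 2 := by
  set s : ℝ := √3 with hs
  have hs0 : 0 < s := Real.sqrt_pos.2 (by norm_num)
  have hs2 : s < 2 := (Real.sqrt_lt' (by norm_num)).2 (by norm_num)
  set α : ℝ := (x.1 + x.2) / 2 with hα
  set β : ℝ := (x.1 - x.2) / (2 * s) with hβ
  have hβs : β * s = (x.1 - x.2) / 2 := by rw [hβ]; field_simp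
  have h1 := abs_le.1 (abs_sub_round α)
  have h2 := abs_le.1 (abs_sub_round β)
  -- α and β are the coordinates of `x` in the basis 1, √3; rounding costs at most (1 + √3) / 2 < 2.
  refine ⟨⟨round α, round β⟩, ?_⟩
  rw [Prod.norm_def, max_le_iff]
  constructor
  · change |x.1 - embOne _| ≤ 2
    rw [embOne_apply, ← hs, abs_le]
    constructor <;> nlinarith
  · change |x.2 - embTwo _| ≤ 2
    rw [embTwo_apply, ← hs, abs_le]
    constructor <;> nlinarith

theorem TotallyPositive.pow {x : ℤ√3} (hx : TotallyPositive x) (n : ℕ) :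
    TotallyPositive (x ^ n) :=
  ⟨by rw [map_pow]; exact pow_pos hx.1 n, by rw [map_pow]; exact pow_pos hx.2 n⟩

theorem totallyPositive_fundUnit : TotallyPositive fundUnit := by
  have h1 : 0 ≤ √(3 : ℝ) := Real.sqrt_nonneg _
  have h2 : √(3 : ℝ) < 2 := (Real.sqrt_lt' (by norm_num)).2 (by norm_num)
  constructor
  · rw [embOne_apply, fundUnit]; push_cast; linarith
  · rw [embTwo_apply, fundUnit]; push_cast; linarith

theorem isUnit_fundUnit : IsUnit fundUnit := IsUnit.of_mul_eq_one _ fundUnit_mul_det_matGInt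

theorem fundUnit_pow_injective : Function.Injective fun n : ℕ => fundUnit ^ n := by
  have h : 1 < embOne fundUnit := by
    have h1 : 0 ≤ √(3 : ℝ) := Real.sqrt_nonneg _
    rw [embOne_apply, fundUnit]; push_cast; linarith
  intro m n hmn
  have := congrArg embOne hmn
  simp only [map_pow] at this
  exact pow_right_injective₀ (zero_lt_one.trans h) h.ne' this

/-- A totally positive element is a square in `ℝ × ℝ`. -/
theorem exists_sq_eq_emb {u : ℤ√3} (hp : TotallyPositive u) :
    ∃ a d : ℝ × ℝ, a * d = 1 ∧ a ^ 2 = emb u := by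
  obtain ⟨d, hd⟩ := exists_mul_eq_one (x := (√(embOne u), √(embTwo u)))
    (Real.sqrt_pos.2 hp.1).ne' (Real.sqrt_pos.2 hp.2).ne'
  exact ⟨_, d, hd, Prod.ext (Real.sq_sqrt hp.1.le) (Real.sq_sqrt hp.2.le)⟩

/-! ### Matrix identities -/

section

variable {R : Type*} [CommRing R]

theorem conj_upper_coe (g : SL(2, R)) (e : R) : (g * upper e * g⁻¹).val =
    !![1 - g 0 0 * g 1 0 * e, g 0 0 ^ 2 * e; -g 1 0 ^ 2 * e, 1 + g 0 0 * g 1 0 * e] := by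
  have h := det_entries g
  rw [Matrix.SpecialLinearGroup.coe_mul, Matrix.SpecialLinearGroup.coe_mul,
    Matrix.SpecialLinearGroup.coe_inv, Matrix.adjugate_fin_two, Matrix.eta_fin_two g.val,
    coe_upper]
  ext i j
  fin_cases i <;> fin_cases j <;> simp [Matrix.mul_apply]
  · linear_combination h
  · ring
  · ring
  · linear_combination h

theorem diag_conj_coe (a d : R) (h : a * d = 1) (g : SL(2, R)) :
    (diag a d h * g * (diag a d h)⁻¹).val =
      !![g 0 0, a ^ 2 * g 0 1; d ^ 2 * g 1 0, g 1 1] := by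
  rw [diag_inv, Matrix.SpecialLinearGroup.coe_mul, Matrix.SpecialLinearGroup.coe_mul,
    Matrix.eta_fin_two g.val, coe_diag, coe_diag]
  ext i j
  fin_cases i <;> fin_cases j <;> simp [Matrix.mul_apply]
  · linear_combination g 0 0 * h
  · ring
  · ring
  · linear_combination g 1 1 * h

theorem upper_mul_mul_upper_coe (x y : R) (g : SL(2, R)) :
    (upper x * g * upper y).val = !![g 0 0 + x * g 1 0,
      g 0 1 + x * g 1 1 + (g 0 0 + x * g 1 0) * y; g 1 0, g 1 1 + g 1 0 * y] := by
  rw [Matrix.SpecialLinearGroup.coe_mul, Matrix.SpecialLinearGroup.coe_mul,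
    Matrix.eta_fin_two g.val, coe_upper, coe_upper]
  ext i j
  fin_cases i <;> fin_cases j <;> simp [Matrix.mul_apply]
  · ring
  · ring

end

/-! ### Discrete groups containing the extended modular group -/

/-- A bounded sequence in the preimage of a discrete group has two terms of equal class. -/
theorem exists_proj_eq_of_bounded (Δ : Subgroup (PGLPosReal × PGLPosReal)) [DiscreteTopology Δ]
    (s : ℕ → SL(2, ℝ × ℝ)) (hs : ∀ k, proj (s k) ∈ Δ) (C : ℝ)
    (hC : ∀ k i j, ‖(s k).val i j‖ ≤ C) : ∃ k l, k < l ∧ proj (s k) = proj (s l) := by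
  have : FirstCountableTopology (Matrix (Fin 2) (Fin 2) (ℝ × ℝ)) :=
    inferInstanceAs (FirstCountableTopology (Fin 2 → Fin 2 → ℝ × ℝ))
  have hemb := Matrix.SpecialLinearGroup.isClosedEmbedding_val (n := Fin 2) (R := ℝ × ℝ)
  have : FirstCountableTopology SL(2, ℝ × ℝ) := hemb.isInducing.firstCountableTopology
  have hK : IsCompact {A : Matrix (Fin 2) (Fin 2) (ℝ × ℝ) | ∀ i j, ‖A i j‖ ≤ C} := by
    have h : IsCompact (Set.univ.pi fun _ : Fin 2 => Set.univ.pi fun _ : Fin 2 =>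
      Metric.closedBall (0 : ℝ × ℝ) C) :=
      isCompact_univ_pi fun _ => isCompact_univ_pi fun _ => isCompact_closedBall _ _
    have e : {A : Matrix (Fin 2) (Fin 2) (ℝ × ℝ) | ∀ i j, ‖A i j‖ ≤ C} =
        Set.univ.pi fun _ : Fin 2 => Set.univ.pi fun _ : Fin 2 =>
          Metric.closedBall (0 : ℝ × ℝ) C := by
      ext A
      change (∀ i j, ‖A i j‖ ≤ C) ↔
        ∀ i ∈ Set.univ, ∀ j ∈ Set.univ, A i j ∈ Metric.closedBall 0 C
      simp only [Set.mem_univ, forall_true_left, mem_closedBall_zero_iff]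
    exact e ▸ h
  have hK' : IsCompact {g : SL(2, ℝ × ℝ) | ∀ i j, ‖g.val i j‖ ≤ C} := hemb.isCompact_preimage hK
  obtain ⟨g, -, φ, hφ, hlim⟩ := hK'.tendsto_subseq (x := s) hC
  -- Successive quotients along a convergent subsequence tend to 1; discreteness makes their images
  -- eventually equal to 1.
  have hlim2 : Filter.Tendsto (fun n => (s (φ n))⁻¹ * s (φ (n + 1))) Filter.atTop (𝓝 1) := by
    rw [← inv_mul_cancel g]
    exact hlim.inv.mul (hlim.comp (Filter.tendsto_add_atTop_nat 1))
  have hlim3 := (continuous_proj.tendsto 1).comp hlim2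
  rw [map_one] at hlim3
  let u : ℕ → Δ := fun n => ⟨proj ((s (φ n))⁻¹ * s (φ (n + 1))), by
    rw [map_mul, map_inv]; exact Δ.mul_mem (Δ.inv_mem (hs _)) (hs _)⟩
  have hu : Filter.Tendsto u Filter.atTop (𝓝 1) := tendsto_subtype_rng.2 hlim3
  rw [nhds_discrete, Filter.tendsto_pure] at hu
  obtain ⟨n, hn⟩ := hu.exists
  refine ⟨φ n, φ (n + 1), hφ n.lt_succ_self, ?_⟩
  have h := congrArg Subtype.val hn
  simp only [u, map_mul, map_inv, Subgroup.coe_one] at h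
  exact inv_mul_eq_one.1 h

section Maximality

variable {Δ : Subgroup (PGLPosReal × PGLPosReal)}

theorem emb_mem (hle : usualEmbedding.range ≤ Δ) (g : SL(2, ℤ√3)) :
    Matrix.SpecialLinearGroup.map emb g ∈ Δ.comap proj := hle (proj_map_emb_mem g)

theorem upper_emb_mem (hle : usualEmbedding.range ≤ Δ) (q : ℤ√3) :
    upper (emb q) ∈ Δ.comap proj := by
  rw [← map_upper]; exact emb_mem hle _

variable (Δ) in
/-- The translations contained in the preimage of `Δ`. -/
def translations : AddSubgroup (ℝ × ℝ) where
  carrier := {x | upper x ∈ Δ.comap proj}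
  zero_mem' := by rw [Set.mem_ofPred_eq, upper_zero]; exact one_mem _
  add_mem' {x y} hx hy := by rw [Set.mem_ofPred_eq, upper_add]; exact mul_mem hx hy
  neg_mem' {x} hx := by rw [Set.mem_ofPred_eq, upper_neg]; exact inv_mem hx

theorem mem_translations {x : ℝ × ℝ} : x ∈ translations Δ ↔ upper x ∈ Δ.comap proj := Iff.rfl

/-- Conjugation by diag(√ε, 1/√ε) multiplies translations by ε, and O = ℤ + ℤε. Since ε is not a
square in O, this needs the extended group and not just PSL₂(O). -/
theorem emb_mul_mem_translations (hle : usualEmbedding.range ≤ Δ) (q : ℤ√3) {x : ℝ × ℝ}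
    (hx : x ∈ translations Δ) : emb q * x ∈ translations Δ := by
  have hε : emb fundUnit * x ∈ translations Δ := by
    obtain ⟨a, d, had, ha⟩ := exists_sq_eq_emb totallyPositive_fundUnit
    have hd : diag a d had ∈ Δ.comap proj :=
      hle (proj_diag_mem isUnit_fundUnit totallyPositive_fundUnit had ha)
    rw [mem_translations, ← ha, ← diag_conj_upper a d had]
    exact mul_mem (mul_mem hd hx) (inv_mem hd)
  have h : q = ((q.re - 2 * q.im : ℤ) : ℤ√3) + ((q.im : ℤ) : ℤ√3) * fundUnit := by
    ext <;> simp [fundUnit]; ring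
  rw [h, map_add, map_mul, map_intCast, map_intCast, add_mul, mul_assoc, ← zsmul_eq_mul,
    ← zsmul_eq_mul]
  exact add_mem (zsmul_mem hx _) (zsmul_mem hε _)

theorem emb_mem_translations (hle : usualEmbedding.range ≤ Δ) (q : ℤ√3) :
    emb q ∈ translations Δ := upper_emb_mem hle q

/-- Reduce each translation modulo the lattice to a bounded one; two of the reduced translations
must then coincide. -/
theorem exists_sub_eq_emb [DiscreteTopology Δ] (hle : usualEmbedding.range ≤ Δ) (x : ℕ → ℝ × ℝ)
    (hx : ∀ k, x k ∈ translations Δ) : ∃ k l, k < l ∧ ∃ q, x k - x l = emb q := by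
  choose q hq using fun k => exists_norm_sub_emb_le (x k)
  obtain ⟨k, l, hkl, h⟩ := exists_proj_eq_of_bounded Δ (fun k => upper (x k - emb (q k)))
    (fun k => sub_mem (hx k) (emb_mem_translations hle (q k))) 2 (fun k i j => by
      fin_cases i <;> fin_cases j <;> simp [hq])
  obtain ⟨r, -, hr⟩ := exists_sq_eq_one_of_proj_eq h
  have h1 := hr 0 0
  have h2 := hr 0 1
  simp only [coe_upper, Matrix.of_apply, Matrix.cons_val', Matrix.cons_val_zero,
    Matrix.cons_val_one, mul_one] at h1 h2
  rw [← h1, one_mul] at h2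
  refine ⟨k, l, hkl, q k - q l, ?_⟩
  rw [map_sub]
  linear_combination -h2

/-- The translations in a discrete group containing the extended modular group are integral. -/
theorem exists_eq_emb_of_mem_translations [DiscreteTopology Δ] (hle : usualEmbedding.range ≤ Δ)
    {x : ℝ × ℝ} (hx : x ∈ translations Δ) : ∃ q, x = emb q := by
  -- Among the multiples of `x` two differ by a lattice element, so `x` is a fraction a/b, taken
  -- below in lowest terms. It remains to show that b is a unit.
  obtain ⟨k, l, hkl, q, hq⟩ := exists_sub_eq_emb hle (fun k => k • x) fun k => nsmul_mem hx k
  have hb : ((k : ℤ√3) - l) ≠ 0 := sub_ne_zero.2 (by exact_mod_cast hkl.ne)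
  obtain ⟨m, a, b, hm, rfl, hmb, u, v, huv⟩ := exists_coprime_reduction q hb
  obtain ⟨m', hm'⟩ := exists_emb_mul_eq_one hm
  have hbx : emb b * x = emb a := by
    have h1 : emb m * emb b = k - l := by rw [← map_mul, ← hmb]; simp
    simp only [nsmul_eq_mul, map_mul] at hq
    linear_combination m' * hq + (emb a - emb b * x) * hm' + x * m' * h1
  -- By the Bézout relation ua + vb = 1, this translation is 1/b. Hence diag(1/b, b) is in the
  -- group, and conjugating by it yields all translations b⁻²ⁿ.
  set t : ℝ × ℝ := emb u * x + emb v with ht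
  have htmem : t ∈ translations Δ :=
    add_mem (emb_mul_mem_translations hle u hx) (emb_mem_translations hle v)
  have htb : t * emb b = 1 := by
    rw [← map_one emb, ← huv, map_add, map_mul, map_mul, ht]
    linear_combination emb u * hbx
  have hd : diag t (emb b) htb ∈ Δ.comap proj := by
    rw [diag_eq_mul, ← map_neg, ← map_lower, ← map_rot emb]
    exact mul_mem (mul_mem (mul_mem htmem (emb_mem hle _)) htmem) (emb_mem hle _)
  have hpow : ∀ n : ℕ, t ^ (2 * n) ∈ translations Δ := by
    intro n
    induction n with
    | zero => simpa using emb_mem_translations hle 1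
    | succ n ih =>
      rw [mul_add, mul_one, add_comm, pow_add, mem_translations, ← diag_conj_upper t _ htb]
      exact mul_mem (mul_mem hd ih) (inv_mem hd)
  obtain ⟨i, j, hij, p, hp⟩ := exists_sub_eq_emb hle _ hpow
  obtain ⟨n, rfl⟩ := Nat.exists_eq_add_of_lt hij
  -- Two of these translations differ by an integral p; clearing denominators shows that b divides
  -- 1.
  have h1 : emb (b ^ (2 * n + 2) - 1) = emb (b ^ (2 * (i + n + 1)) * p) := by
    have hti : t ^ (2 * i) * emb b ^ (2 * i) = 1 := by rw [← mul_pow, htb, one_pow]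
    have htj : t ^ (2 * (i + n + 1)) * emb b ^ (2 * (i + n + 1)) = 1 := by
      rw [← mul_pow, htb, one_pow]
    have hpw : emb b ^ (2 * (i + n + 1)) = emb b ^ (2 * i) * emb b ^ (2 * n + 2) := by ring
    rw [map_mul, ← hp, map_sub, map_pow, map_pow, map_one]
    linear_combination htj - emb b ^ (2 * n + 2) * hti - t ^ (2 * i) * hpw
  have h2 := emb_injective h1
  have hu : IsUnit b := by
    refine isUnit_of_dvd_one ⟨b ^ (2 * n + 1) - b ^ (2 * (i + n) + 1) * p, ?_⟩
    linear_combination -h2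
  obtain ⟨w, hw⟩ := hu.exists_right_inv
  refine ⟨w * a, ?_⟩
  have hw' : emb b * emb w = 1 := by rw [← map_mul, hw, map_one]
  rw [map_mul]
  linear_combination emb w * hbx - x * hw'

/-- The stabilizer of the cusp at infinity in a discrete group containing the extended modular
group. -/
theorem proj_mem_of_lower_left_eq_zero [DiscreteTopology Δ] (hle : usualEmbedding.range ≤ Δ)
    {g : SL(2, ℝ × ℝ)} (hg : g ∈ Δ.comap proj) (hc : g 1 0 = 0) :
    proj g ∈ usualEmbedding.range := by
  obtain ⟨had, hgd⟩ := eq_diag_mul_upper g hc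
  have hone : upper (1 : ℝ × ℝ) ∈ Δ.comap proj := by simpa using upper_emb_mem hle 1
  -- Conjugating the translation by 1 with g and g⁻¹ gives the squares of the diagonal entries. Both
  -- are thus integral, with product 1, so they are totally positive units.
  have ha : g 0 0 ^ 2 ∈ translations Δ := by
    have h : upper (g 0 0 ^ 2) = g * upper 1 * g⁻¹ := by
      apply Subtype.ext
      rw [conj_upper_coe, hc, coe_upper]
      simp
    rw [mem_translations, h]
    exact mul_mem (mul_mem hg hone) (inv_mem hg)
  have hd : g 1 1 ^ 2 ∈ translations Δ := by
    have h : upper (g 1 1 ^ 2) = g⁻¹ * upper 1 * g⁻¹⁻¹ := by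
      apply Subtype.ext
      rw [conj_upper_coe, coe_upper, Matrix.SpecialLinearGroup.coe_inv, Matrix.adjugate_fin_two]
      simp [hc]
    rw [mem_translations, h]
    exact mul_mem (mul_mem (inv_mem hg) hone) (inv_mem (inv_mem hg))
  obtain ⟨u, hu⟩ := exists_eq_emb_of_mem_translations hle ha
  obtain ⟨w, hw⟩ := exists_eq_emb_of_mem_translations hle hd
  have huw : u * w = 1 := emb_injective (by
    rw [map_mul, ← hu, ← hw, ← mul_pow, had, one_pow, map_one])
  have hunit : IsUnit u := IsUnit.of_mul_eq_one _ huw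
  have hpos : TotallyPositive u := by
    have h1 : embOne u = (g 0 0).1 ^ 2 := (congrArg Prod.fst hu).symm
    have h2 : embTwo u = (g 0 0).2 ^ 2 := (congrArg Prod.snd hu).symm
    have h3 : embOne u ≠ 0 := (map_ne_zero_iff _ embOne_injective).2 hunit.ne_zero
    have h4 : embTwo u ≠ 0 := (map_ne_zero_iff _ embTwo_injective).2 hunit.ne_zero
    exact ⟨lt_of_le_of_ne (h1 ▸ sq_nonneg _) h3.symm, lt_of_le_of_ne (h2 ▸ sq_nonneg _) h4.symm⟩
  have hdiag := proj_diag_mem hunit hpos had hu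
  have hup : g 1 1 * g 0 1 ∈ translations Δ := by
    rw [hgd] at hg
    exact (Subgroup.mul_mem_cancel_left (Δ.comap proj) (hle hdiag)).1 hg
  obtain ⟨q, hq⟩ := exists_eq_emb_of_mem_translations hle hup
  rw [hgd, map_mul, hq, ← map_upper]
  exact mul_mem hdiag (proj_map_emb_mem _)

/-- The cusps of a discrete group containing the extended modular group are rational. -/
theorem exists_mul_emb_eq_mul_emb [DiscreteTopology Δ] (hle : usualEmbedding.range ≤ Δ)
    {g : SL(2, ℝ × ℝ)} (hg : g ∈ Δ.comap proj) {c' : ℝ × ℝ} (hc : g 1 0 * c' = 1) :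
    ∃ p q : ℤ√3, p ≠ 0 ∧ g 0 0 * emb p = g 1 0 * emb q := by
  set a := g 0 0
  set c := g 1 0
  have hc2 : c ^ 2 * c' ^ 2 = 1 := by rw [← mul_pow, hc, one_pow]
  -- Conjugate the translation by εᵏ with g, then with a diagonal matrix rescaling the lower left
  -- entry from -c²εᵏ to -c². Integral translations on the left and right then bound the diagonal
  -- entries independently of k.
  have hseq : ∀ k : ℕ, ∃ (q : ℤ√3) (s : SL(2, ℝ × ℝ)), s ∈ Δ.comap proj ∧
      s 1 0 = -c ^ 2 ∧ s 0 0 = 1 - a * c * emb fundUnit ^ k - emb q * c ^ 2 ∧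
      ‖s 0 0‖ ≤ ‖c ^ 2‖ * 2 ∧ ‖s 1 1‖ ≤ ‖c ^ 2‖ * 2 := by
    intro k
    have hpos := totallyPositive_fundUnit.pow k
    obtain ⟨η, η', hη, hη2⟩ := exists_sq_eq_emb hpos
    have hdiag : diag η η' hη ∈ Δ.comap proj :=
      hle (proj_diag_mem (isUnit_fundUnit.pow k) hpos hη hη2)
    rw [map_pow] at hη2
    have hη' : η' ^ 2 * emb fundUnit ^ k = 1 := by
      rw [← hη2, ← mul_pow, mul_comm, hη, one_pow]
    set h := diag η η' hη * (g * upper (emb (fundUnit ^ k)) * g⁻¹) * (diag η η' hη)⁻¹ with hh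
    have hmem : h ∈ Δ.comap proj := mul_mem (mul_mem hdiag
      (mul_mem (mul_mem hg (upper_emb_mem hle _)) (inv_mem hg))) (inv_mem hdiag)
    have h00 : h 0 0 = 1 - a * c * emb fundUnit ^ k := by
      rw [hh, diag_conj_coe, conj_upper_coe, map_pow]; rfl
    have h11 : h 1 1 = 1 + a * c * emb fundUnit ^ k := by
      rw [hh, diag_conj_coe, conj_upper_coe, map_pow]; rfl
    have h10 : h 1 0 = -c ^ 2 := by
      have : h 1 0 = η' ^ 2 * (-c ^ 2 * emb fundUnit ^ k) := by
        rw [hh, diag_conj_coe, conj_upper_coe, map_pow]; rfl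
      rw [this]
      linear_combination -c ^ 2 * hη'
    obtain ⟨q, hq⟩ := exists_norm_sub_emb_le (h 0 0 * c' ^ 2)
    obtain ⟨p, hp⟩ := exists_norm_sub_emb_le (h 1 1 * c' ^ 2)
    have hs := upper_mul_mul_upper_coe (emb q) (emb p) h
    refine ⟨q, upper (emb q) * h * upper (emb p),
      mul_mem (mul_mem (upper_emb_mem hle _) hmem) (upper_emb_mem hle _), ?_, ?_, ?_, ?_⟩
    · rw [hs]; simpa using h10
    · rw [hs]; simp [h00, h10]; ring
    · have : (upper (emb q) * h * upper (emb p)).val 0 0 =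
          c ^ 2 * (h 0 0 * c' ^ 2 - emb q) := by
        rw [hs]; simp only [Matrix.of_apply, Matrix.cons_val', Matrix.cons_val_zero, h10]
        linear_combination (-h 0 0) * hc2
      rw [this]
      exact (norm_mul_le _ _).trans (mul_le_mul_of_nonneg_left hq (norm_nonneg _))
    · have : (upper (emb q) * h * upper (emb p)).val 1 1 =
          c ^ 2 * (h 1 1 * c' ^ 2 - emb p) := by
        rw [hs]; simp only [Matrix.of_apply, Matrix.cons_val', Matrix.cons_val_one,
          Matrix.cons_val_fin_one, h10]
        linear_combination (-h 1 1) * hc2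
      rw [this]
      exact (norm_mul_le _ _).trans (mul_le_mul_of_nonneg_left hp (norm_nonneg _))
  choose q s hs hs10 hs00 hb00 hb11 using hseq
  set M : ℝ := ‖c ^ 2‖ * 2
  have hM : 0 ≤ M := by positivity
  -- The determinant recovers the upper right entry, c being invertible.
  have hb01 : ∀ k, ‖s k 0 1‖ ≤ ‖c' ^ 2‖ * (1 + M * M) := by
    intro k
    have hdet := det_entries (s k)
    have : s k 0 1 = c' ^ 2 * (1 - s k 0 0 * s k 1 1) := by
      rw [hs10] at hdet
      linear_combination (-s k 0 1) * hc2 + c' ^ 2 * hdet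
    rw [this]
    refine (norm_mul_le _ _).trans (mul_le_mul_of_nonneg_left ?_ (norm_nonneg _))
    refine (norm_sub_le _ _).trans (add_le_add norm_one.le ((norm_mul_le _ _).trans ?_))
    exact mul_le_mul (hb00 k) (hb11 k) (norm_nonneg _) hM
  have hb10 : ∀ k, ‖s k 1 0‖ ≤ M := fun k => by
    rw [hs10, norm_neg]
    exact le_mul_of_one_le_right (norm_nonneg _) one_le_two
  obtain ⟨k, l, hkl, hproj⟩ := exists_proj_eq_of_bounded Δ s hs
    (max M (‖c' ^ 2‖ * (1 + M * M))) (fun k i j => by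
      fin_cases i <;> fin_cases j
      · exact (hb00 k).trans (le_max_left _ _)
      · exact (hb01 k).trans (le_max_right _ _)
      · exact (hb10 k).trans (le_max_left _ _)
      · exact (hb11 k).trans (le_max_left _ _))
  obtain ⟨r, -, hr⟩ := exists_sq_eq_one_of_proj_eq hproj
  -- The lower left entry is the same invertible -c² for all k. With r = 1, equality of the upper
  -- left entries is the required relation between a and c; the coefficient of a is nonzero because
  -- ε has infinite order.
  have hr1 : r = 1 := by
    have h := hr 1 0
    rw [hs10, hs10] at h
    linear_combination c' ^ 2 * h + (1 - r) * hc2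
  have h00 := hr 0 0
  rw [hr1, one_mul, hs00, hs00] at h00
  refine ⟨fundUnit ^ l - fundUnit ^ k, q k - q l,
    sub_ne_zero.2 fun h => hkl.ne' (fundUnit_pow_injective h), ?_⟩
  rw [map_sub, map_sub, map_pow, map_pow]
  linear_combination -c' * h00 - (a * (emb fundUnit ^ l - emb fundUnit ^ k)
    - c * (emb (q k) - emb (q l))) * hc

/-- Each expression vanishes for at most one n, so one of 0, 1, 2 works. -/
theorem exists_int_add_mul_ne_zero {a₁ c₁ a₂ c₂ : ℝ} (h1 : a₁ ≠ 0 ∨ c₁ ≠ 0)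
    (h2 : a₂ ≠ 0 ∨ c₂ ≠ 0) : ∃ n : ℤ, c₁ + n * a₁ ≠ 0 ∧ c₂ + n * a₂ ≠ 0 := by
  by_contra! h
  have e0 := h 0
  have e1 := h 1
  have e2 := h 2
  push_cast at e0 e1 e2
  grind

theorem proj_mem_of_mem [DiscreteTopology Δ] (hle : usualEmbedding.range ≤ Δ)
    {g : SL(2, ℝ × ℝ)} (hg : g ∈ Δ.comap proj) : proj g ∈ usualEmbedding.range := by
  -- In `ℝ × ℝ` the lower left entry may vanish in just one factor; an integral lower unipotent
  -- makes it invertible in both.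
  suffices H : ∀ g : SL(2, ℝ × ℝ), g ∈ Δ.comap proj → (∃ c', g 1 0 * c' = 1) →
      proj g ∈ usualEmbedding.range by
    have hdet := det_entries g
    have hd1 : (g 0 0).1 * (g 1 1).1 - (g 0 1).1 * (g 1 0).1 = 1 := congrArg Prod.fst hdet
    have hd2 : (g 0 0).2 * (g 1 1).2 - (g 0 1).2 * (g 1 0).2 = 1 := congrArg Prod.snd hdet
    obtain ⟨n, h1, h2⟩ := exists_int_add_mul_ne_zero
      (a₁ := (g 0 0).1) (c₁ := (g 1 0).1) (a₂ := (g 0 0).2) (c₂ := (g 1 0).2)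
      (by by_contra! h; simp [h] at hd1) (by by_contra! h; simp [h] at hd2)
    have hmem := H (Matrix.SpecialLinearGroup.map emb (lower (n : ℤ√3)) * g)
      (mul_mem (emb_mem hle _) hg) (by
        have h10 : (Matrix.SpecialLinearGroup.map emb (lower (n : ℤ√3)) * g).val 1 0 =
            g 1 0 + n * g 0 0 := by
          rw [map_lower, map_intCast, Matrix.SpecialLinearGroup.coe_mul, Matrix.mul_apply,
            Fin.sum_univ_two]
          simp [add_comm]
        rw [h10]
        exact exists_mul_eq_one (by simpa using h1) (by simpa using h2))
    rw [map_mul] at hmem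
    exact (Subgroup.mul_mem_cancel_left _ (proj_map_emb_mem _)).1 hmem
  rintro g hg ⟨c', hc⟩
  obtain ⟨p, q, hp, hpq⟩ := exists_mul_emb_eq_mul_emb hle hg hc
  obtain ⟨m, q', p', hm, rfl, rfl, u, v, huv⟩ := exists_coprime_reduction q hp
  obtain ⟨m', hm'⟩ := exists_emb_mul_eq_one hm
  -- The Bézout relation completes (p', -q') to a matrix of SL₂(O) sending the cusp q'/p' of g to ∞.
  let γ : SL(2, ℤ√3) := ⟨!![-u, -v; p', -q'], by
    rw [Matrix.det_fin_two_of]; linear_combination huv⟩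
  have h10 : (Matrix.SpecialLinearGroup.map emb γ * g).val 1 0 = 0 := by
    have h : (Matrix.SpecialLinearGroup.map emb γ * g).val 1 0 =
        emb p' * g 0 0 + emb (-q') * g 1 0 := by
      rw [Matrix.SpecialLinearGroup.coe_mul, Matrix.mul_apply, Fin.sum_univ_two]; rfl
    rw [map_mul, map_mul] at hpq
    rw [h, map_neg]
    linear_combination m' * hpq - (emb p' * g 0 0 - emb q' * g 1 0) * hm'
  have hmem := proj_mem_of_lower_left_eq_zero hle (mul_mem (emb_mem hle γ) hg) h10
  rw [map_mul] at hmem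
  exact (Subgroup.mul_mem_cancel_left _ (proj_map_emb_mem _)).1 hmem

end Maximality

theorem maximal_range_usualEmbedding :
    Maximal (fun Δ : Subgroup (PGLPosReal × PGLPosReal) => DiscreteTopology Δ)
      usualEmbedding.range := by
  refine ⟨discreteTopology_range_usualEmbedding, fun Δ hΔ hle x hx => ?_⟩
  obtain ⟨g, rfl⟩ := proj_surjective x
  exact proj_mem_of_mem hle hx

end HilbertModular

theorem mainTheorem4 :
    -- `PSL₂(ℤ[√3])` embeds in `PSL₂(ℂ)`, and `Γ` contains it with index two
    (Function.Injective HilbertModular.pslMap ∧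
      HilbertModular.pslMap.range ≤ HilbertModular.monodromyGroup ∧
      HilbertModular.pslMap.range.relIndex HilbertModular.monodromyGroup = 2) ∧
    -- `PGL₂⁺(ℤ[√3])` embeds in `PGL₂(ℂ) = PSL₂(ℂ)`, and its image there is `Γ`
    (Function.Injective
        (Matrix.ProjGenLinGroup.map (n := Fin 2) HilbertModular.embC) ∧
      HilbertModular.monodromyGroup.map Matrix.ProjectiveSpecialLinearGroup.toPGL =
        HilbertModular.PGLTotPos.map
          (Matrix.ProjGenLinGroup.map (n := Fin 2) HilbertModular.embC)) ∧
    -- the usual embedding identifies it with the Hurwitz–Maass extension, which is maximal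
    -- among the discrete subgroups of `PGL₂⁺(ℝ)²`
    (Function.Injective HilbertModular.usualEmbedding ∧
      HilbertModular.usualEmbedding.range = HilbertModular.hurwitzMaass ∧
      Maximal
        (fun Δ : Subgroup (HilbertModular.PGLPosReal × HilbertModular.PGLPosReal) =>
          DiscreteTopology Δ)
        HilbertModular.usualEmbedding.range) := by
  exact ⟨⟨HilbertModular.pslMap_injective, HilbertModular.range_pslMap_le,
      HilbertModular.relIndex_range_pslMap⟩,
    ⟨HilbertModular.projGenLinGroup_map_injective HilbertModular.embC_injective,
      le_antisymm HilbertModular.map_monodromyGroup_le HilbertModular.le_map_monodromyGroup⟩,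
    HilbertModular.usualEmbedding_injective, HilbertModular.range_usualEmbedding,
    HilbertModular.maximal_range_usualEmbedding⟩
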